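/- Let $[\overline n]:=\{1<2<\dots<n<\overline n<\dots<\overline 2<\overline 1\}$, with the involution $i\mapsto\overline{\imath}$, $\overline{\overline{\imath}}=i$, and $|i|=|\overline{\imath}|=i$ for $i\in[n]$. Let $B_n$ be the group of signed permutations, i.e. bijections $w$ of $[\overline n]$ with $w(\overline{\imath})=\overline{w(i)}$, with length $\ell(w)=\#\{(k,l)\in[n]\times[\overline n]: k\le |l|,\ w(k)>w(l)\}$. The positive roots of type $C_n$ are $\varepsilon_i-\varepsilon_j$, denoted $(i,j)$, and $\varepsilon_i+\varepsilon_j$, denoted $(i,\overline{\jmath})$, for $1\le i<j\le n$, and $2\varepsilon_i$, denoted $(i,\overline{\imath})$, for $1\le i\le n$; the corresponding reflections $s_\alpha\in B_n$ are $t_{ij}t_{\overline{\jmath}\,\overline{\imath}}$, $t_{i\overline{\jmath}}t_{j\overline{\imath}}$ and $t_{i\overline{\imath}}$, where $t_{ab}$ is the transposition of $a,b\in[\overline n]$. Let $\rho=(n,n-1,\dots,1)$ and $\alpha^\vee=2\alpha/\langle\alpha,\alpha\rangle$. The quantum Bruhat graph on $B_n$ has an edge $w\to ws_\alpha$ labelled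 by the positive root $\alpha$ if $\ell(ws_\alpha)=\ell(w)+1$ or $\ell(ws_\alpha)=\ell(w)-2\langle\rho,\alpha^\vee\rangle+1$. For $k\le n$ let $\Gamma_r(k)$ be the concatenation $\Gamma_2\cdots\Gamma_k$, where $\Gamma_i=((1,\overline{\imath}),(2,\overline{\imath}),\dots,(i-1,\overline{\imath}))$, and let $\mathrm{rev}$ denote reversal of a sequence. A column of height $k$ is a sequence $C=(C(1),\dots,C(k))$ in $[\overline n]$ whose entries have pairwise distinct absolute values; $\mathrm{ord}(C)$ is $C$ sorted increasingly; and $w[1,k]:=(w(1),\dots,w(k))$. For two columns $C',C$ of height $k$, the pair $C'C$ satisfies Condition 1$'$ if for no $1\le i<l\le k$ one has $C(i)=C'(l)$ or $C(i)\prec C'(l)\prec C'(i)$, where $a\prec b\prec c$ means that $a,b,c$ are distinct and are met in this order when going around the circle $1,2,\dots,n,\overline n,\dots,\overline 1$ from $a$. A KN (Kashiwara-Nakashima) column of height $k$ is a strictly increasing sequence $D$ of $k$ elements of $[\overline n]$ (which may contain both $z$ and $\overline z$) with the following property. Let $z_1>\dots>z_r$ be all the $z\in[n]$ with $z,\overline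 z\in D$; then there are $t_1>\dots>t_r$ in $[n]$ such that $t_1$ is the greatest $t\in[n]$ with $t<z_1$ and $t,\overline t\notin D$, and, for $i\ge 2$, $t_i$ is the greatest $t\in[n]$ with $t<\min(t_{i-1},z_i)$ and $t,\overline t\notin D$. Then $rD$ (respectively $lD$) is obtained from $D$ by replacing each $\overline{z_i}$ by $\overline{t_i}$ (respectively each $z_i$ by $t_i$) and sorting increasingly. **Proposition.** Let $k\le n$, let $u\in B_n$, let $C:=u[1,k]$, and let $C'$ be a column of height $k$. Then the pair $C'C$ satisfies Condition 1$'$ and $(\mathrm{ord}(C'),\mathrm{ord}(C))=(rD,lD)$ for some KN column $D$ if and only if there is a path $u=u_0,u_1,\dots,u_p=v$ in the quantum Bruhat graph such that $v[1,k]=C'$ and the sequence of edge labels is a subsequence of $\mathrm{rev}(\Gamma_r(k))$. Moreover, such a path is unique if it exists, and along it, for each $i=1,\dots,k$, one has $C(i)=u_0(i)\le u_1(i)\le\dots\le u_p(i)=C'(i)$, with all these entries in $[n]$ or all of them in $[\overline n]\setminus[n]$. -/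

import Mathlib

namespace TypeC

/-- The ordered alphabet `1 < 2 < ⋯ < n < n̄ < ⋯ < 2̄ < 1̄`, realised as `Fin (2 * n)`: the letter
`i` is the element of value `i - 1`, and `ī` is the element of value `2n - i`. The linear order is
that of `Fin (2 * n)`, and the circular order is the one Mathlib puts on `Fin (2 * n)`. -/
abbrev Letter (n : ℕ) : Type := Fin (2 * n)

/-- The order-reversing involution `i ↦ ī`. -/
def bar {n : ℕ} (x : Letter n) : Letter n := Fin.rev x

/-- The inclusion of `[n]` in the alphabet. -/
def pos {n : ℕ} (i : Fin n) : Letter n := ⟨i.1, by omega⟩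

/-- `x` is unbarred, that is, `x ∈ [n]`. -/
def IsUnbarred {n : ℕ} (x : Letter n) : Prop := x.1 < n

/-- The absolute value `|i| = |ī| = i`. -/
def absLetter {n : ℕ} (x : Letter n) : Letter n := min x (bar x)

theorem bar_bar {n : ℕ} (x : Letter n) : bar (bar x) = x := Fin.rev_rev x

theorem bar_injective {n : ℕ} : Function.Injective (bar : Letter n → Letter n) :=
  Fin.rev_injective

/-- The group `B_n` of signed permutations: the permutations `w` of the alphabet such that
`w(ī)` is the bar of `w(i)`. -/
def SignedPerm (n : ℕ) : Subgroup (Equiv.Perm (Letter n)) where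
  carrier := {w | ∀ x, w (bar x) = bar (w x)}
  mul_mem' := by
    intro a b ha hb x
    simp only [Equiv.Perm.mul_apply]
    rw [hb, ha]
  one_mem' := by intro x; rfl
  inv_mem' := by
    intro a ha x
    rw [Equiv.Perm.inv_eq_iff_eq, ha]
    simp

/-- The length of a signed permutation, as a number of inversions:
`ℓ(w) = #{(k, l) ∈ [n] × [n̄] : k ≤ |l|, w(k) > w(l)}`. -/
def length {n : ℕ} (w : SignedPerm n) : ℕ :=
  (Finset.univ.filter fun p : Fin n × Letter n =>
    pos p.1 ≤ absLetter p.2 ∧ w.1 p.2 < w.1 (pos p.1)).card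

/-- The positive roots of type `C_n`. -/
inductive PosRoot (n : ℕ) : Type
  /-- `(i, j)`, the root `ε_i - ε_j`. -/
  | minus (i j : Fin n) (h : i < j) : PosRoot n
  /-- `(i, j̄)`, the root `ε_i + ε_j`. -/
  | plus (i j : Fin n) (h : i < j) : PosRoot n
  /-- `(i, ī)`, the root `2 ε_i`. -/
  | long (i : Fin n) : PosRoot n

/-- The coroot `α^∨ = 2 α / ⟨α, α⟩`, in the coordinates `ε_1, …, ε_n`. -/
def PosRoot.coroot {n : ℕ} : PosRoot n → Fin n → ℤ
  | .minus i j _ => Pi.single i 1 - Pi.single j 1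
  | .plus i j _ => Pi.single i 1 + Pi.single j 1
  | .long i => Pi.single i 1

/-- `ρ = (n, n - 1, …, 1)`, half the sum of the positive roots. -/
def rho (n : ℕ) : Fin n → ℤ := fun i => (n : ℤ) - (i.1 : ℤ)

/-- The reflection of a positive root, as a permutation of the alphabet. -/
def PosRoot.reflPerm {n : ℕ} : PosRoot n → Equiv.Perm (Letter n)
  | .minus i j _ => Equiv.swap (pos i) (pos j) * Equiv.swap (bar (pos j)) (bar (pos i))
  | .plus i j _ => Equiv.swap (pos i) (bar (pos j)) * Equiv.swap (pos j) (bar (pos i))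
  | .long i => Equiv.swap (pos i) (bar (pos i))

theorem PosRoot.reflPerm_mem {n : ℕ} (α : PosRoot n) : α.reflPerm ∈ SignedPerm n := by
  intro x
  cases α with
  | minus i j h =>
    simp only [reflPerm, Equiv.Perm.mul_apply, Equiv.swap_apply_def, pos, bar, Fin.ext_iff] at *
    split_ifs <;> simp only [Fin.val_rev] at * <;> omega
  | plus i j h =>
    simp only [reflPerm, Equiv.Perm.mul_apply, Equiv.swap_apply_def, pos, bar, Fin.ext_iff] at *
    split_ifs <;> simp only [Fin.val_rev] at * <;> omega
  | long i =>
    simp only [reflPerm, Equiv.swap_apply_def, pos, bar, Fin.ext_iff] at *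
    split_ifs <;> simp only [Fin.val_rev] at * <;> omega

/-- The reflection `s_α` in the Weyl group `B_n`. -/
def PosRoot.refl {n : ℕ} (α : PosRoot n) : SignedPerm n := ⟨α.reflPerm, α.reflPerm_mem⟩

/-- The edge `w ⟶ w'` labelled by `α` of the quantum Bruhat graph: `w' = w s_α`, and either
`ℓ(w s_α) = ℓ(w) + 1` (a Bruhat edge) or `ℓ(w s_α) = ℓ(w) - 2⟨ρ, α^∨⟩ + 1` (a quantum edge). -/
def QBEdge {n : ℕ} (w : SignedPerm n) (α : PosRoot n) (w' : SignedPerm n) : Prop :=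
  w' = w * α.refl ∧
    ((length w' : ℤ) = length w + 1 ∨
      (length w' : ℤ) = length w - 2 * (rho n ⬝ᵥ α.coroot) + 1)

/-- A list `[(α₁, u₁), …, (α_p, u_p)]` is a path in the quantum Bruhat graph from `u = u₀` if
`u_{j-1} ⟶ u_j` is an edge labelled by `α_j` for all `j`. -/
def IsQBPath {n : ℕ} : SignedPerm n → List (PosRoot n × SignedPerm n) → Prop
  | _, [] => True
  | u, (α, w) :: P => QBEdge u α w ∧ IsQBPath w P

/-- The sequence of edge labels of a path. -/
def labels {n : ℕ} (P : List (PosRoot n × SignedPerm n)) : List (PosRoot n) := P.map Prod.fst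

/-- The sequence of vertices `u₀ = u, u₁, …, u_p` of a path from `u`. -/
def vertices {n : ℕ} (u : SignedPerm n) (P : List (PosRoot n × SignedPerm n)) :
    List (SignedPerm n) := u :: P.map Prod.snd

/-- The last vertex `u_p` of a path from `u`. -/
def endpoint {n : ℕ} (u : SignedPerm n) (P : List (PosRoot n × SignedPerm n)) : SignedPerm n :=
  (vertices u P).getLast (List.cons_ne_nil _ _)

/-- `Γ_r(k) = Γ_2 ⋯ Γ_k`, where `Γ_i = ((1, ī), (2, ī), …, (i - 1, ī))`. (The segment for `i = 1`
is empty.) -/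
def GammaR {n : ℕ} (k : ℕ) (hk : k ≤ n) : List (PosRoot n) :=
  (List.finRange k).flatMap fun i =>
    (List.finRange i.1).map fun j =>
      PosRoot.plus ⟨j.1, by omega⟩ ⟨i.1, by omega⟩ (by simp [Fin.lt_def])

/-- The column `w[1, k] = w(1) ⋯ w(k)`. -/
def window {n k : ℕ} (hk : k ≤ n) (w : SignedPerm n) : Fin k → Letter n :=
  fun i => w.1 (pos (Fin.castLE hk i))

/-- A column of height `k` (a column of a filling): entries with pairwise distinct absolute
values, in any order. -/
def IsColumn {n k : ℕ} (C : Fin k → Letter n) : Prop :=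
  Function.Injective fun i => absLetter (C i)

/-- The pair `C'C`: for no `i < l` is `C(i) = C'(l)` or `C(i) ≺ C'(l) ≺ C'(i)`. The latter is
strict betweenness in the circular order of the alphabet. -/
def ConditionOne {n k : ℕ} (C' C : Fin k → Letter n) : Prop :=
  ∀ i l : Fin k, i < l → C i ≠ C' l ∧ ¬ sbtw (C i) (C' l) (C' i)

/-- Sorting a column in increasing order. -/
def ord {n k : ℕ} (C : Fin k → Letter n) : Fin k → Letter n := C ∘ Tuple.sort C

open Classical in
/-- The set `I` of unbarred letters `z` such that both `z` and `z̄` occur in `D`. -/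
noncomputable def pairSet {n k : ℕ} (D : Fin k → Letter n) : Finset (Letter n) :=
  Finset.univ.filter fun z => IsUnbarred z ∧ z ∈ Set.range D ∧ bar z ∈ Set.range D

/-- The decreasing enumeration `z₁ > ⋯ > z_r` of `I`. -/
noncomputable def pairSeq {n k : ℕ} (D : Fin k → Letter n) :
    Fin (pairSet D).card → Letter n :=
  fun i => (pairSet D).orderEmbOfFin rfl (Fin.rev i)

/-- The sequence `t₁, …, t_r` splits `D`: each `t_i` is the greatest letter `t ∈ [n]` with
`t < z_i`, `t < t_{i-1}` (if `i > 1`), `t ∉ D` and `t̄ ∉ D`. -/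
def IsSplitting {n k : ℕ} (D : Fin k → Letter n) (t : Fin (pairSet D).card → Letter n) : Prop :=
  ∀ i, IsGreatest {x : Letter n | IsUnbarred x ∧ x < pairSeq D i ∧
    (∀ j, j.1 + 1 = i.1 → x < t j) ∧ x ∉ Set.range D ∧ bar x ∉ Set.range D} (t i)

/-- A Kashiwara–Nakashima column of height `k`: a strictly increasing filling that can be split.
The splitting sequence is determined by the entries. -/
structure KNColumn (n k : ℕ) where
  entries : Fin k → Letter n
  strictMono : StrictMono entries
  t : Fin (pairSet entries).card → Letter n
  isSplitting : IsSplitting entries t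

/-- `rD`: change each `z̄_i` into `t̄_i` in `D`, and reorder. -/
noncomputable def KNColumn.right {n k : ℕ} (D : KNColumn n k) : Fin k → Letter n :=
  ord (Function.extend (bar ∘ pairSeq D.entries) (bar ∘ D.t) id ∘ D.entries)

/-- `lD`: change each `z_i` into `t_i` in `D`, and reorder. -/
noncomputable def KNColumn.left {n k : ℕ} (D : KNColumn n k) : Fin k → Letter n :=
  ord (Function.extend (pairSeq D.entries) D.t id ∘ D.entries)

/-- `P` is a path `u = u₀, u₁, …, u_p = v` in the quantum Bruhat graph such that `v[1, k] = C'` and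
the edge labels form a subsequence of the reverse of `Γ_r(k)`. -/
def IsRightPath {n k : ℕ} (hk : k ≤ n) (u : SignedPerm n) (C' : Fin k → Letter n)
    (P : List (PosRoot n × SignedPerm n)) : Prop :=
  IsQBPath u P ∧ window hk (endpoint u P) = C' ∧ (labels P).Sublist (GammaR k hk).reverse

end TypeC

/-! Letters are encoded by the numbers `0, …, 2n - 1`, so that the bar is `y ↦ 2n - 1 - y`. An edge
labelled `ε_i + ε_j` replaces the entries at `i` and `j` by the bars of `w(j)` and `w(i)`. A length
count (`qbEdge_plus_iff`) shows that such an edge is never quantum, and that it is one exactly when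
the entry at `i` (equivalently, at `j`) rises, stays on its side of the alphabet, and jumps over no
value forbidden by the positions after `i`. Monotonicity and constancy of barredness follow at once.

The reversed root sequence is a chain of segments: the segment of position `i` pairs `i` with `i -
1, …, 1` in turn, and no later segment touches `i`. Within a segment the entry at `i` climbs, and it
can never pass over the bar of a partner that was already declined. So its target decides at each
root whether the root is used, which gives uniqueness (`path_unique`); taking a root whenever it
does not overshoot gives existence.

The condition on `(rD, lD)` becomes a counting condition, `Compatible`: `C` and `C'` have the same
absolute values, and for every `y` at most as many entries of `C` as of `C'` are `≥ y`, with
equality at `n` and at letters whose absolute value is absent. Indeed, passing from `lD` to `rD`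
moves `t_i` up to `z_i` and `z̄_i` up to `t̄_i`, and the greedy choice of the `t_i` means exactly
that no absent letter is crossed. Given entrywise monotonicity, `Compatible` amounts to `Ascent`,
the invariant of paths.

The main difficulty is that, after the greedy first segment, the target is still an ascent for the
remaining positions (`Ascent.after_segment`). There the entrywise comparison is recovered from
counts, using that the excess of one count over the other is symmetric under `y ↦ 2n - y`
(`cnt_symm`). -/

namespace TypeC

/-! ### Signed permutations as numerical functions -/

/-- The value `w(i)` of a signed permutation at `i ∈ [n]`, as a natural number. -/
def val {n : ℕ} (w : SignedPerm n) (i : Fin n) : ℕ := (w.1 (pos i)).1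

theorem val_lt {n : ℕ} (w : SignedPerm n) (i : Fin n) : val w i < 2 * n := (w.1 (pos i)).2

theorem bar_val {n : ℕ} (x : Letter n) : (bar x).1 + x.1 + 1 = 2 * n := by
  have := x.2
  simp only [bar, Fin.val_rev]
  omega

theorem apply_bar {n : ℕ} (w : SignedPerm n) (x : Letter n) : w.1 (bar x) = bar (w.1 x) := w.2 x

theorem pos_injective {n : ℕ} : Function.Injective (pos : Fin n → Letter n) := by
  intro i j h
  simpa [pos, Fin.ext_iff] using h

theorem pos_ne_bar_pos {n : ℕ} (i j : Fin n) : pos i ≠ bar (pos j) := by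
  intro h
  have h1 := bar_val (pos j)
  rw [← h] at h1
  simp only [pos] at h1
  omega

theorem val_injective {n : ℕ} (w : SignedPerm n) : Function.Injective (val w) := by
  intro i j h
  exact pos_injective (w.1.injective (Fin.ext h))

theorem val_add_val_ne {n : ℕ} (w : SignedPerm n) (i j : Fin n) :
    val w i + val w j + 1 ≠ 2 * n := by
  intro h
  have h1 := bar_val (w.1 (pos j))
  have h2 : w.1 (pos i) = bar (w.1 (pos j)) := by
    apply Fin.ext
    simp only [val] at h
    omega
  rw [← apply_bar] at h2
  exact pos_ne_bar_pos i j (w.1.injective h2)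

theorem letter_cases {n : ℕ} (x : Letter n) : ∃ i : Fin n, x = pos i ∨ x = bar (pos i) := by
  have hx := x.2
  by_cases h : x.1 < n
  · exact ⟨⟨x.1, h⟩, Or.inl rfl⟩
  · refine ⟨⟨2 * n - 1 - x.1, by omega⟩, Or.inr ?_⟩
    apply Fin.ext
    simp only [bar, pos, Fin.val_rev]
    omega

theorem exists_val_eq {n : ℕ} (w : SignedPerm n) {y : ℕ} (hy : y < 2 * n) :
    ∃ i : Fin n, val w i = y ∨ val w i + y + 1 = 2 * n := by
  obtain ⟨i, hi⟩ := letter_cases (w.1.symm ⟨y, hy⟩)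
  refine ⟨i, ?_⟩
  rcases hi with hi | hi
  · left
    simp [val, ← hi]
  · right
    have h1 := bar_val (w.1 (pos i))
    rw [← apply_bar, ← hi] at h1
    simp only [Equiv.apply_symm_apply] at h1
    simp only [val]
    omega

theorem sum_letter {n : ℕ} {M : Type*} [AddCommMonoid M] (f : Letter n → M) :
    ∑ x, f x = ∑ i : Fin n, (f (pos i) + f (bar (pos i))) := by
  rw [Finset.sum_add_distrib]
  have h1 : ∑ i : Fin n, f (pos i) = ∑ x : Letter n with x.1 < n, f x := by
    classical
    refine Finset.sum_bij (fun i _ => pos i) ?_ (fun _ _ _ _ h => pos_injective h) ?_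
      (fun _ _ => rfl)
    · intro i _
      simp [pos]
    · intro x hx
      exact ⟨⟨x.1, by simpa using hx⟩, Finset.mem_univ _, rfl⟩
  have h2 : ∑ i : Fin n, f (bar (pos i)) = ∑ x : Letter n with ¬ x.1 < n, f x := by
    classical
    refine Finset.sum_bij (fun i _ => bar (pos i)) ?_
      (fun _ _ _ _ h => pos_injective (bar_injective h)) ?_ (fun _ _ => rfl)
    · intro i _
      have := bar_val (pos i)
      simp only [pos] at this
      simp only [Finset.mem_filter, Finset.mem_univ, true_and, pos]
      omega
    · intro x hx
      have hx' : ¬ x.1 < n := by simpa using hx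
      obtain ⟨i, hi | hi⟩ := letter_cases x
      · exact absurd (by rw [hi]; exact i.2) hx'
      · exact ⟨i, Finset.mem_univ _, hi.symm⟩
  rw [h1, h2]
  classical
  exact (Finset.sum_filter_add_sum_filter_not _ _ _).symm

/-! ### Change of length under the reflection in `ε_i + ε_j` -/

/-- Inversions contributed by the values `x`, `y` at two positions `i ≤ j`, where the letters are
encoded by odd integers in such a way that the involution is the negation. -/
def invPair (x y : ℤ) : ℤ := (if y < x then 1 else 0) + (if -y < x then 1 else 0)

/-- The odd integer encoding `w(i)`. -/
def oddVal {n : ℕ} (w : SignedPerm n) (i : Fin n) : ℤ := 2 * (val w i : ℤ) + 1 - 2 * n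

theorem length_eq_sum {n : ℕ} (w : SignedPerm n) :
    (length w : ℤ) =
      ∑ k : Fin n, ∑ l : Fin n, if k ≤ l then invPair (oddVal w k) (oddVal w l) else 0 := by
  have h : (length w : ℤ) = ∑ p : Fin n × Letter n,
      if pos p.1 ≤ absLetter p.2 ∧ w.1 p.2 < w.1 (pos p.1) then (1 : ℤ) else 0 := by
    rw [length, Finset.card_filter]
    push_cast
    rfl
  rw [h, Fintype.sum_prod_type]
  refine Finset.sum_congr rfl fun k _ => ?_
  rw [sum_letter]
  refine Finset.sum_congr rfl fun l _ => ?_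
  have hl := bar_val (pos l)
  have hw := bar_val (w.1 (pos l))
  have e1 : absLetter (pos l) = pos l := by
    apply min_eq_left
    rw [Fin.le_def]
    simp only [pos] at hl ⊢
    omega
  have e2 : absLetter (bar (pos l)) = pos l := by
    unfold absLetter
    rw [bar_bar, min_comm]
    exact e1
  have e3 : pos k ≤ pos l ↔ k ≤ l := Iff.rfl
  simp only [e1, e2, e3, apply_bar, Fin.lt_def, invPair, oddVal, val]
  by_cases hkl : k ≤ l
  · simp only [hkl, true_and, if_true]
    congr 1
    · refine if_congr ?_ rfl rfl
      omega
    · refine if_congr ?_ rfl rfl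
      omega
  · simp [hkl]

theorem val_mul {n : ℕ} (w r : SignedPerm n) (i : Fin n) :
    val (w * r) i = (w.1 (r.1 (pos i))).1 := rfl

section Reflection

variable {n : ℕ} (w : SignedPerm n) {i j : Fin n} (h : i < j)

theorem val_mul_refl_left : val (w * (PosRoot.plus i j h).refl) i + val w j + 1 = 2 * n := by
  have h1 : (PosRoot.plus i j h).reflPerm (pos i) = bar (pos j) := by
    have : pos i ≠ pos j := fun h' => h.ne (pos_injective h')
    simp only [PosRoot.reflPerm, Equiv.Perm.mul_apply]
    rw [Equiv.swap_apply_of_ne_of_ne this (pos_ne_bar_pos i i), Equiv.swap_apply_left]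
  have h2 := bar_val (w.1 (pos j))
  rw [← apply_bar] at h2
  rw [val_mul, PosRoot.refl, h1]
  exact h2

theorem val_mul_refl_right : val (w * (PosRoot.plus i j h).refl) j + val w i + 1 = 2 * n := by
  have h1 : (PosRoot.plus i j h).reflPerm (pos j) = bar (pos i) := by
    have : bar (pos i) ≠ bar (pos j) := fun h' => h.ne (pos_injective (bar_injective h'))
    simp only [PosRoot.reflPerm, Equiv.Perm.mul_apply, Equiv.swap_apply_left]
    rw [Equiv.swap_apply_of_ne_of_ne (pos_ne_bar_pos i i).symm this]
  have h2 := bar_val (w.1 (pos i))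
  rw [← apply_bar] at h2
  rw [val_mul, PosRoot.refl, h1]
  exact h2

theorem val_mul_refl_of_ne {m : Fin n} (hi : m ≠ i) (hj : m ≠ j) :
    val (w * (PosRoot.plus i j h).refl) m = val w m := by
  have h1 : (PosRoot.plus i j h).reflPerm (pos m) = pos m := by
    simp only [PosRoot.reflPerm, Equiv.Perm.mul_apply]
    rw [Equiv.swap_apply_of_ne_of_ne (fun h' => hj (pos_injective h')) (pos_ne_bar_pos m i),
      Equiv.swap_apply_of_ne_of_ne (fun h' => hi (pos_injective h')) (pos_ne_bar_pos m j)]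
  rw [val_mul, PosRoot.refl, h1]
  rfl

end Reflection

/-- Contribution of the position `m` to the change of length when the values `a`, `-b` at the
positions `i < j` are changed into `b`, `-a`. -/
def lengthChange {n : ℕ} (i j m : Fin n) (a b c : ℤ) : ℤ :=
  (if i < m then (if c < b then 1 else 0) - (if c < a then 1 else 0) else 0) +
  (if j < m then (if -c < b then 1 else 0) - (if -c < a then 1 else 0) else 0)

theorem sum_pair_expand {ι M : Type*} [Fintype ι] [DecidableEq ι] [AddCommMonoid M] {i j : ι}
    (hij : i ≠ j) (d : ι → ι → M) (hd : ∀ k l, k ≠ i → k ≠ j → l ≠ i → l ≠ j → d k l = 0) :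
    ∑ k, ∑ l, d k l = (d i i + d i j + d j i + d j j) +
      ∑ m ∈ (Finset.univ.erase i).erase j, (d m i + d m j + d i m + d j m) := by
  have key : ∀ f : ι → M, ∑ m, f m = f i + f j + ∑ m ∈ (Finset.univ.erase i).erase j, f m := by
    intro f
    rw [← Finset.add_sum_erase _ f (Finset.mem_univ i),
      ← Finset.add_sum_erase _ f (Finset.mem_erase.2 ⟨hij.symm, Finset.mem_univ j⟩), add_assoc]
  have hr : ∑ k ∈ (Finset.univ.erase i).erase j, ∑ l, d k l =
      ∑ k ∈ (Finset.univ.erase i).erase j, (d k i + d k j) := by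
    refine Finset.sum_congr rfl fun k hk => ?_
    simp only [Finset.mem_erase, Finset.mem_univ, and_true] at hk
    rw [key, Finset.sum_eq_zero, add_zero]
    intro l hl
    simp only [Finset.mem_erase, Finset.mem_univ, and_true] at hl
    exact hd k l hk.2 hk.1 hl.2 hl.1
  rw [key (fun k => ∑ l, d k l), key (d i), key (d j), hr]
  simp only [Finset.sum_add_distrib]
  abel

theorem invPair_change_self {a b : ℤ} (h1 : a ≠ -b) (h2 : a ≠ -a) (h3 : b ≠ -b) :
    (invPair (-b) (-b) - invPair a a) + (invPair (-b) (-a) - invPair a b) +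
      (invPair (-a) (-a) - invPair b b) = (if a < -b then 1 else -1) +
        2 * ((if 0 < -b then 1 else 0) - (if 0 < a then 1 else 0)) := by
  simp only [invPair, neg_neg, lt_self_iff_false, if_false]
  have i1 : (b < -b) ↔ 0 < -b := by omega
  have i2 : (-a < a) ↔ 0 < a := by omega
  have i3 : (-a < -b) ↔ b < a := by omega
  have i4 : (a < -a) ↔ ¬ 0 < a := by omega
  have i5 : (-b < b) ↔ ¬ 0 < -b := by omega
  have i6 : (-b < a) ↔ ¬ a < -b := by omega
  simp only [i1, i2, i3, i4, i5, i6]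
  split_ifs <;> norm_num

theorem invPair_change_between {a b c : ℤ} (h1 : c ≠ a) (h2 : c ≠ b) (h3 : c ≠ -a)
    (h4 : c ≠ -b) :
    (invPair b c - invPair a c) + (invPair c (-a) - invPair c (-b)) =
      2 * ((if c < b then 1 else 0) - (if c < a then 1 else 0)) := by
  simp only [invPair, neg_neg]
  have i1 : (-c < b) ↔ (-b < c) := by omega
  have i2 : (-a < c) ↔ (-c < a) := by omega
  have i3 : (a < c) ↔ ¬ (c < a) := by omega
  have i5 : (b < c) ↔ ¬ (c < b) := by omega
  simp only [i1, i2, i3, i5]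
  split_ifs <;> norm_num

theorem invPair_change_right {a b c : ℤ} (h1 : c ≠ a) (h2 : c ≠ b) (h3 : c ≠ -a)
    (h4 : c ≠ -b) :
    (invPair b c - invPair a c) + (invPair (-a) c - invPair (-b) c) =
      2 * (((if c < b then 1 else 0) - (if c < a then 1 else 0)) +
        ((if -c < b then 1 else 0) - (if -c < a then 1 else 0))) := by
  simp only [invPair]
  have i1 : (-c < -b) ↔ ¬ (c < b) := by omega
  have i2 : (c < -a) ↔ ¬ (-c < a) := by omega
  have i3 : (-c < -a) ↔ ¬ (c < a) := by omega
  have i5 : (c < -b) ↔ ¬ (-c < b) := by omega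
  simp only [i1, i2, i3, i5]
  split_ifs <;> norm_num

/-- Only pairs of positions meeting `{i, j}` matter. The pairs inside `{i, j}` give the sign and the
change in the number of barred entries. Each other `m` contributes an even amount, nonzero only if a
letter `w(m)` or its bar separates the old entry at `i` from the new one. -/
theorem length_mul_refl {n : ℕ} (w : SignedPerm n) {i j : Fin n} (h : i < j) :
    (length (w * (PosRoot.plus i j h).refl) : ℤ) = length w +
      ((if oddVal w i < -oddVal w j then 1 else -1) +
        2 * ((if 0 < -oddVal w j then 1 else 0) - (if 0 < oddVal w i then 1 else 0)) +
        2 * ∑ m ∈ (Finset.univ.erase i).erase j,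
          lengthChange i j m (oddVal w i) (-oddVal w j) (oddVal w m)) := by
  set w' := w * (PosRoot.plus i j h).refl with hw'
  have ei : oddVal w' i = -oddVal w j := by
    have : val w' i + val w j + 1 = 2 * n := val_mul_refl_left w h
    simp only [oddVal]
    omega
  have ej : oddVal w' j = -oddVal w i := by
    have : val w' j + val w i + 1 = 2 * n := val_mul_refl_right w h
    simp only [oddVal]
    omega
  have em : ∀ m, m ≠ i → m ≠ j → oddVal w' m = oddVal w m := by
    intro m h1 h2
    have : val w' m = val w m := val_mul_refl_of_ne w h h1 h2
    simp only [oddVal]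
    omega
  have hne : ∀ p q, p ≠ q → oddVal w p ≠ oddVal w q := by
    intro p q hpq h'
    apply hpq
    apply val_injective w
    simp only [oddVal] at h'
    omega
  have hne' : ∀ p q, oddVal w p ≠ -oddVal w q := by
    intro p q h'
    apply val_add_val_ne w p q
    simp only [oddVal] at h'
    omega
  rw [← sub_eq_iff_eq_add', length_eq_sum, length_eq_sum, ← Finset.sum_sub_distrib]
  simp only [← Finset.sum_sub_distrib]
  rw [sum_pair_expand h.ne]
  · have h0 : ¬ j ≤ i := not_le.2 h
    rw [Finset.mul_sum]
    congr 1
    · simp only [ei, ej, le_refl, if_true, h.le, h0, if_false]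
      rw [← invPair_change_self (hne' i j) (hne' i i) (hne' j j)]
      ring
    · refine Finset.sum_congr rfl fun m hm => ?_
      simp only [Finset.mem_erase, Finset.mem_univ, and_true] at hm
      simp only [ei, ej, em m hm.2 hm.1]
      have a1 := hne m i hm.2
      have a2 := hne m j hm.1
      have a3 := hne' m i
      have a4 := hne' m j
      rcases lt_or_gt_of_ne hm.2 with h1 | h1
      · have h2 := h1.trans h
        simp only [lengthChange, h1.le, h2.le, not_le.2 h1, not_le.2 h2, not_lt.2 h1.le,
          not_lt.2 h2.le, if_true, if_false, invPair, neg_neg]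
        ring_nf
      · rcases lt_or_gt_of_ne hm.1 with h2 | h2
        · simp only [lengthChange, h1, h1.le, h2.le, not_le.2 h1, not_le.2 h2, not_lt.2 h2.le,
            if_true, if_false]
          rw [add_zero, ← invPair_change_between a1 a4 a3 (by rwa [neg_neg])]
          ring_nf
        · simp only [lengthChange, h1, h2, h1.le, h2.le, not_le.2 h1, not_le.2 h2, if_true,
            if_false]
          rw [← invPair_change_right a1 a4 a3 (by rwa [neg_neg])]
          ring_nf
  · intro k l h1 h2 h3 h4
    rw [em k h1 h2, em l h3 h4, sub_self]

/-! ### Edges labelled `ε_i + ε_j` -/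

/-- The combinatorial form of an edge `w ⟶ w'` labelled by the root `ε_i + ε_j`. -/
structure Step {n : ℕ} (w : SignedPerm n) (i j : Fin n) (w' : SignedPerm n) : Prop where
  lt : i < j
  left : val w' i + val w j + 1 = 2 * n
  right : val w' j + val w i + 1 = 2 * n
  of_ne : ∀ m, m ≠ i → m ≠ j → val w' m = val w m
  val_lt_val : val w i < val w' i
  side : val w i < n ↔ val w' i < n
  between : ∀ m, i < m → m < j → ¬ (val w i < val w m ∧ val w m < val w' i)
  beyond : ∀ m, j < m → ¬ (val w i < val w m ∧ val w m < val w' i) ∧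
    ¬ (val w j < val w m ∧ val w m < val w' j)

theorem lengthChange_nonneg {n : ℕ} (i j m : Fin n) {a b c : ℤ} (h : a < b) :
    0 ≤ lengthChange i j m a b c := by
  unfold lengthChange
  split_ifs <;> omega

theorem lengthChange_nonpos {n : ℕ} (i j m : Fin n) {a b c : ℤ} (h : b ≤ a) :
    lengthChange i j m a b c ≤ 0 := by
  unfold lengthChange
  split_ifs <;> omega

theorem lengthChange_ge {n : ℕ} {i j : Fin n} (m : Fin n) {a b c : ℤ} :
    -((if i < m then 1 else 0) + (if j < m then 1 else 0)) ≤ lengthChange i j m a b c := by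
  unfold lengthChange
  split_ifs <;> omega

theorem lengthChange_eq_zero_iff {n : ℕ} {i j m : Fin n} {a b c : ℤ} (h : a < b) (h1 : c ≠ a)
    (h3 : -c ≠ a) :
    lengthChange i j m a b c = 0 ↔
      (i < m → ¬ (a < c ∧ c < b)) ∧ (j < m → ¬ (a < -c ∧ -c < b)) := by
  unfold lengthChange
  by_cases him : i < m <;> by_cases hjm : j < m <;>
    simp only [him, hjm, if_true, if_false, true_imp_iff, false_imp_iff, true_and, and_true] <;>
    (try split_ifs) <;> first | omega | simp

theorem rho_dotProduct_plus {n : ℕ} (i j : Fin n) (h : i < j) :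
    rho n ⬝ᵥ (PosRoot.plus i j h).coroot = 2 * n - i.1 - j.1 := by
  simp only [PosRoot.coroot, dotProduct_add, dotProduct_single_one, rho]
  ring

theorem card_filter_lt_fin {n : ℕ} (i : Fin n) :
    ∑ m : Fin n, (if i < m then (1 : ℤ) else 0) = n - 1 - i.1 := by
  have h := Fin.card_Ioi i
  have hi := i.2
  rw [Finset.sum_boole]
  have : (Finset.univ.filter fun m : Fin n => i < m) = Finset.Ioi i := by
    ext m
    simp
  rw [this, h]
  omega

/-- Each `m` loses at most one for each of `i`, `j` lying below it. There are `(n - 1 - i) + (n - 1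
- j)` such pairs, and `m = j` above `i` is excluded from the sum. This bound is what rules out
quantum edges. -/
theorem sum_lengthChange_ge {n : ℕ} (w : SignedPerm n) {i j : Fin n} (h : i < j) (a b : ℤ) :
    -(2 * (n : ℤ) - i.1 - j.1 - 3) ≤
      ∑ m ∈ (Finset.univ.erase i).erase j, lengthChange i j m a b (oddVal w m) := by
  have h1 : ∑ m ∈ (Finset.univ.erase i).erase j,
      -(((if i < m then 1 else 0) + (if j < m then 1 else 0) : ℤ)) ≤
      ∑ m ∈ (Finset.univ.erase i).erase j, lengthChange i j m a b (oddVal w m) :=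
    Finset.sum_le_sum fun m _ => lengthChange_ge m
  refine le_trans (le_of_eq ?_) h1
  rw [Finset.sum_neg_distrib]
  congr 1
  have h2 : ∑ m : Fin n, (((if i < m then 1 else 0) + (if j < m then 1 else 0) : ℤ)) =
      2 * (n : ℤ) - i.1 - j.1 - 2 := by
    rw [Finset.sum_add_distrib, card_filter_lt_fin, card_filter_lt_fin]
    ring
  rw [← Finset.add_sum_erase _ _ (Finset.mem_univ i),
    ← Finset.add_sum_erase _ _ (Finset.mem_erase.2 ⟨h.ne', Finset.mem_univ j⟩)] at h2
  simp only [lt_self_iff_false, if_false, h, if_true, not_lt.2 h.le] at h2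
  linarith

theorem qbEdge_plus_iff {n : ℕ} (w w' : SignedPerm n) {i j : Fin n} (h : i < j) :
    QBEdge w (.plus i j h) w' ↔ w' = w * (PosRoot.plus i j h).refl ∧ Step w i j w' := by
  unfold QBEdge
  refine and_congr_right fun hw' => ?_
  have hl := length_mul_refl w h
  have hge := sum_lengthChange_ge w h (oddVal w i) (-oddVal w j)
  rw [← hw'] at hl
  have hL : val w' i + val w j + 1 = 2 * n := hw' ▸ val_mul_refl_left w h
  have hR : val w' j + val w i + 1 = 2 * n := hw' ▸ val_mul_refl_right w h
  have hN : ∀ m, m ≠ i → m ≠ j → val w' m = val w m :=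
    fun m h1 h2 => hw' ▸ val_mul_refl_of_ne w h h1 h2
  have hi := i.2
  have hj := j.2
  have hij : i.1 < j.1 := h
  have hne := val_add_val_ne w i j
  rw [rho_dotProduct_plus]
  have ea : oddVal w i < -oddVal w j ↔ val w i < val w' i := by
    simp only [oddVal]
    omega
  have e1 : 0 < -oddVal w j ↔ ¬ val w' i < n := by
    simp only [oddVal]
    omega
  have e2 : 0 < oddVal w i ↔ ¬ val w i < n := by
    simp only [oddVal]
    omega
  simp only [ea, e1, e2] at hl
  by_cases hlt : val w i < val w' i
  · have hab : oddVal w i < -oddVal w j := ea.2 hlt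
    have hnn : ∀ m ∈ (Finset.univ.erase i).erase j,
        0 ≤ lengthChange i j m (oddVal w i) (-oddVal w j) (oddVal w m) :=
      fun m _ => lengthChange_nonneg i j m hab
    have hsum := Finset.sum_nonneg hnn
    have hz := Finset.sum_eq_zero_iff_of_nonneg hnn
    have hm : ∀ m, m ≠ i → m ≠ j →
        (lengthChange i j m (oddVal w i) (-oddVal w j) (oddVal w m) = 0 ↔
          (i < m → ¬ (val w i < val w m ∧ val w m < val w' i)) ∧
          (j < m → ¬ (val w j < val w m ∧ val w m < val w' j))) := by
      intro m h1 h2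
      have n1 := val_add_val_ne w m i
      have n2 : val w m ≠ val w i := fun h' => h1 (val_injective w h')
      rw [lengthChange_eq_zero_iff hab (by simp only [oddVal]; omega)
        (by simp only [oddVal]; omega)]
      refine and_congr (imp_congr_right fun _ => ?_) (imp_congr_right fun _ => ?_)
      · simp only [oddVal]
        omega
      · simp only [oddVal]
        omega
    have hz' : (∑ m ∈ (Finset.univ.erase i).erase j,
        lengthChange i j m (oddVal w i) (-oddVal w j) (oddVal w m) = 0) ↔
        (∀ m, i < m → m < j → ¬ (val w i < val w m ∧ val w m < val w' i)) ∧
        (∀ m, j < m → ¬ (val w i < val w m ∧ val w m < val w' i) ∧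
          ¬ (val w j < val w m ∧ val w m < val w' j)) := by
      rw [hz]
      simp only [Finset.mem_erase, Finset.mem_univ, and_true]
      constructor
      · intro H
        refine ⟨fun m h1 h2 => ((hm m h1.ne' h2.ne).1 (H m ⟨h2.ne, h1.ne'⟩)).1 h1, fun m h1 => ?_⟩
        have := (hm m (h.trans h1).ne' h1.ne').1 (H m ⟨h1.ne', (h.trans h1).ne'⟩)
        exact ⟨this.1 (h.trans h1), this.2 h1⟩
      · rintro ⟨H1, H2⟩ m ⟨h1, h2⟩
        rw [hm m h2 h1]
        refine ⟨fun h3 => ?_, fun h3 => (H2 m h3).2⟩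
        rcases lt_or_gt_of_ne h1 with h4 | h4
        · exact H1 m h3 h4
        · exact (H2 m h4).1
    simp only [hlt, if_true] at hl
    generalize (∑ m ∈ (Finset.univ.erase i).erase j,
        lengthChange i j m (oddVal w i) (-oddVal w j) (oddVal w m)) = s at *
    constructor
    · intro H
      -- The length changes by `1 + 2e + 2s` with `e ∈ {0, 1}` recording a change of side and `s ≥
      -- 0`. This is positive, while the quantum change is negative, so the change is `1` and `e = s
      -- = 0`.
      have hs : (val w i < n ↔ val w' i < n) ∧ s = 0 := by
        split_ifs at hl <;> omega
      obtain ⟨H1, H2⟩ := hz'.1 hs.2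
      exact ⟨h, hL, hR, hN, hlt, hs.1, H1, H2⟩
    · intro H
      have hs := hz'.2 ⟨H.between, H.beyond⟩
      have := H.side
      left
      split_ifs at hl <;> omega
  -- When the entry at `i` falls, the length drops, but by at most `2(2n - i - j) - 3`, whereas a
  -- quantum edge needs a drop of `2(2n - i - j) - 1`.
  · refine iff_of_false ?_ fun H => hlt H.val_lt_val
    have hnp : ∑ m ∈ (Finset.univ.erase i).erase j,
        lengthChange i j m (oddVal w i) (-oddVal w j) (oddVal w m) ≤ 0 :=
      Finset.sum_nonpos fun m _ =>
        lengthChange_nonpos i j m (not_lt.1 fun h' => hlt (ea.1 h'))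
    simp only [hlt, if_false] at hl
    generalize (∑ m ∈ (Finset.univ.erase i).erase j,
        lengthChange i j m (oddVal w i) (-oddVal w j) (oddVal w m)) = s at *
    split_ifs at hl <;> omega

/-! ### The reversed root sequence and reachability along it -/

/-- The roots `(j, ī), (j - 1, ī), …, (1, ī)`. -/
def segment {n : ℕ} (i : Fin n) : ℕ → List (PosRoot n)
  | 0 => []
  | j + 1 => if h : j < i.1 then .plus ⟨j, h.trans i.2⟩ i h :: segment i j else segment i j

theorem segment_succ {n : ℕ} (i : Fin n) {j : ℕ} (h : j < i.1) :
    segment i (j + 1) = .plus ⟨j, h.trans i.2⟩ i h :: segment i j := by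
  simp [segment, h]

/-- The reverse of `Γ_r(k)`, by recursion on `k`. -/
def revGamma (n : ℕ) : ℕ → List (PosRoot n)
  | 0 => []
  | i + 1 => if h : i < n then segment ⟨i, h⟩ i ++ revGamma n i else revGamma n i

theorem revGamma_succ {n i : ℕ} (h : i < n) :
    revGamma n (i + 1) = segment ⟨i, h⟩ i ++ revGamma n i := by
  simp [revGamma, h]

theorem reverse_map_plus {n : ℕ} (i : Fin n) (j : ℕ) (hj : j ≤ i.1) :
    ((List.finRange j).map fun q => PosRoot.plus ⟨q.1, by omega⟩ i
      (by simp only [Fin.lt_def]; omega)).reverse = segment i j := by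
  induction j with
  | zero => rfl
  | succ j ih =>
    rw [List.finRange_succ_last, segment_succ i (by omega), ← ih (by omega)]
    simp [List.map_map, Function.comp_def]

theorem reverse_GammaR {n k : ℕ} (hk : k ≤ n) : (GammaR k hk).reverse = revGamma n k := by
  induction k with
  | zero => rfl
  | succ k ih =>
    have h := reverse_map_plus (⟨k, hk⟩ : Fin n) k le_rfl
    rw [revGamma_succ hk, ← ih (by omega), ← h, ← List.reverse_append]
    congr 1
    simp only [GammaR, List.finRange_succ_last, List.flatMap_append, List.flatMap_map]
    simp

/-- `Reach L u v`: there is a path from `u` to `v` whose labels form a subsequence of `L`. -/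
inductive Reach {n : ℕ} : List (PosRoot n) → SignedPerm n → SignedPerm n → Prop
  | nil (u : SignedPerm n) : Reach [] u u
  | skip {L : List (PosRoot n)} {u v : SignedPerm n} (α : PosRoot n) :
      Reach L u v → Reach (α :: L) u v
  | take {L : List (PosRoot n)} {u w v : SignedPerm n} {α : PosRoot n} :
      QBEdge u α w → Reach L w v → Reach (α :: L) u v

theorem endpoint_cons {n : ℕ} (u : SignedPerm n) (x : PosRoot n × SignedPerm n)
    (P : List (PosRoot n × SignedPerm n)) : endpoint u (x :: P) = endpoint x.2 P := by
  simp [endpoint, vertices, List.getLast_cons]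

theorem reach_of_path {n : ℕ} {L : List (PosRoot n)} {u : SignedPerm n}
    {P : List (PosRoot n × SignedPerm n)} (hP : IsQBPath u P) (hL : (labels P).Sublist L) :
    Reach L u (endpoint u P) := by
  induction L generalizing u P with
  | nil =>
    have : P = [] := by simpa [labels] using hL
    subst this
    exact .nil u
  | cons α L ih =>
    rcases List.sublist_cons_iff.1 hL with h | ⟨r, hr, h⟩
    · exact .skip α (ih hP h)
    · match P, hr, hP with
      | (β, w) :: P, hr, hP =>
        simp only [labels, List.map_cons, List.cons.injEq] at hr
        obtain ⟨rfl, rfl⟩ := hr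
        rw [endpoint_cons]
        exact .take hP.1 (ih hP.2 h)

theorem Reach.exists_path {n : ℕ} {L : List (PosRoot n)} {u v : SignedPerm n}
    (h : Reach L u v) : ∃ P, IsQBPath u P ∧ endpoint u P = v ∧ (labels P).Sublist L := by
  induction h with
  | nil u => exact ⟨[], trivial, rfl, List.Sublist.refl _⟩
  | skip α _ ih =>
    obtain ⟨P, h1, h2, h3⟩ := ih
    exact ⟨P, h1, h2, h3.cons α⟩
  | @take L u w v α e _ ih =>
    obtain ⟨P, h1, h2, h3⟩ := ih
    exact ⟨(α, w) :: P, ⟨e, h1⟩, by rw [endpoint_cons, h2], h3.cons_cons α⟩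

theorem reach_append_iff {n : ℕ} {L M : List (PosRoot n)} {u v : SignedPerm n} :
    Reach (L ++ M) u v ↔ ∃ w, Reach L u w ∧ Reach M w v := by
  induction L generalizing u with
  | nil =>
    constructor
    · exact fun h => ⟨u, .nil u, h⟩
    · rintro ⟨w, h1, h2⟩
      cases h1
      exact h2
  | cons α L ih =>
    constructor
    · intro h
      cases h with
      | skip _ h =>
        obtain ⟨w, h1, h2⟩ := ih.1 h
        exact ⟨w, .skip α h1, h2⟩
      | take e h =>
        obtain ⟨w, h1, h2⟩ := ih.1 h
        exact ⟨w, .take e h1, h2⟩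
    · rintro ⟨w, h1, h2⟩
      cases h1 with
      | skip _ h => exact .skip α (ih.2 ⟨w, h, h2⟩)
      | take e h => exact .take e (ih.2 ⟨w, h, h2⟩)

/-! ### Invariants of paths -/

/-- The root is `ε_i + ε_j` with `i < j` and `j` among the first `m` positions. -/
def PosRoot.IsPlusBelow {n : ℕ} (m : ℕ) (α : PosRoot n) : Prop :=
  ∃ (i j : Fin n) (h : i < j), α = .plus i j h ∧ j.1 < m

theorem isPlusBelow_of_mem_segment {n : ℕ} {i : Fin n} {j : ℕ} {α : PosRoot n}
    (h : α ∈ segment i j) {m : ℕ} (hm : i.1 < m) : α.IsPlusBelow m := by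
  induction j with
  | zero => simp [segment] at h
  | succ j ih =>
    by_cases hj : j < i.1
    · rw [segment_succ i hj, List.mem_cons] at h
      rcases h with rfl | h
      · exact ⟨_, i, hj, rfl, hm⟩
      · exact ih h
    · simp only [segment, hj, dif_neg, not_false_eq_true] at h
      exact ih h

theorem isPlusBelow_of_mem_revGamma {n k : ℕ} {α : PosRoot n} (h : α ∈ revGamma n k) :
    α.IsPlusBelow k := by
  induction k with
  | zero => simp [revGamma] at h
  | succ k ih =>
    have aux : α ∈ revGamma n k → α.IsPlusBelow (k + 1) := fun h' => by
      obtain ⟨i, j, hij, rfl, hj⟩ := ih h'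
      exact ⟨i, j, hij, rfl, by omega⟩
    by_cases hk : k < n
    · rw [revGamma_succ hk, List.mem_append] at h
      rcases h with h | h
      · exact isPlusBelow_of_mem_segment h (by simp)
      · exact aux h
    · simp only [revGamma, hk, dif_neg, not_false_eq_true] at h
      exact aux h

/-- The letter `y` or its bar is one of the first `m` values of `f`. -/
def InAbs {n : ℕ} (m : ℕ) (f : Fin n → ℕ) (y : ℕ) : Prop :=
  ∃ q : Fin n, q.1 < m ∧ (f q = y ∨ f q + y + 1 = 2 * n)

/-- What a sequence of steps at the first `m` positions may do to the values `f`, giving `f'`. -/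
structure Ascent {n : ℕ} (m : ℕ) (f f' : Fin n → ℕ) : Prop where
  fix : ∀ p, m ≤ p.1 → f' p = f p
  mono : ∀ p, f p ≤ f' p
  side : ∀ p, f p < n ↔ f' p < n
  inAbs : ∀ y, InAbs m f y ↔ InAbs m f' y
  not_cross : ∀ y, y < 2 * n → ¬ InAbs m f y → ∀ p, ¬ (f p < y ∧ y ≤ f' p)

theorem Ascent.refl {n : ℕ} (m : ℕ) (f : Fin n → ℕ) : Ascent m f f :=
  ⟨fun _ _ => rfl, fun _ => le_rfl, fun _ => Iff.rfl, fun _ => Iff.rfl, fun _ _ _ _ => by omega⟩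

theorem Ascent.trans {n m : ℕ} {f f' f'' : Fin n → ℕ} (h : Ascent m f f') (h' : Ascent m f' f'') :
    Ascent m f f'' := by
  refine ⟨fun p hp => (h'.fix p hp).trans (h.fix p hp), fun p => (h.mono p).trans (h'.mono p),
    fun p => (h.side p).trans (h'.side p), fun y => (h.inAbs y).trans (h'.inAbs y),
    fun y hy hn p hp => ?_⟩
  have h1 := h.not_cross y hy hn p
  have h2 := h'.not_cross y hy (fun h3 => hn ((h.inAbs y).2 h3)) p
  omega

/-- A letter whose absolute value is missing from the first `m` positions sits, up to bar, at a
position beyond `j`. The clause `beyond` then forbids both moving entries to cross it. -/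
theorem Step.ascent {n : ℕ} {w w' : SignedPerm n} {i j : Fin n} (h : Step w i j w') {m : ℕ}
    (hm : j.1 < m) : Ascent m (val w) (val w') := by
  have hij : i.1 < j.1 := h.lt
  have hl := h.left
  have hr := h.right
  have hlt := h.val_lt_val
  have hs := h.side
  have cases3 : ∀ p, p = i ∨ p = j ∨ (p ≠ i ∧ p ≠ j) := fun p => by tauto
  refine ⟨fun p hp => h.of_ne p ?_ ?_, fun p => ?_, fun p => ?_, fun y => ⟨?_, ?_⟩, ?_⟩
  · rintro rfl
    omega
  · rintro rfl
    omega
  · rcases cases3 p with rfl | rfl | ⟨h1, h2⟩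
    · omega
    · omega
    · rw [h.of_ne p h1 h2]
  · rcases cases3 p with rfl | rfl | ⟨h1, h2⟩
    · omega
    · omega
    · rw [h.of_ne p h1 h2]
  · rintro ⟨q, hq, hy⟩
    rcases cases3 q with rfl | rfl | ⟨h1, h2⟩
    · exact ⟨j, hm, by omega⟩
    · exact ⟨i, by omega, by omega⟩
    · exact ⟨q, hq, by rwa [h.of_ne q h1 h2]⟩
  · rintro ⟨q, hq, hy⟩
    rcases cases3 q with rfl | rfl | ⟨h1, h2⟩
    · exact ⟨j, hm, by omega⟩
    · exact ⟨i, by omega, by omega⟩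
    · exact ⟨q, hq, by rwa [← h.of_ne q h1 h2]⟩
  · intro y hy hn p hp
    obtain ⟨q, hq⟩ := exists_val_eq w hy
    have hqm : m ≤ q.1 := by
      by_contra hlt
      exact hn ⟨q, not_le.1 hlt, hq⟩
    have hb := h.beyond q (by rw [Fin.lt_def]; omega)
    have n1 : ∀ s, s.1 < m → val w s ≠ y ∧ val w s + y + 1 ≠ 2 * n :=
      fun s hs' => ⟨fun e => hn ⟨s, hs', Or.inl e⟩, fun e => hn ⟨s, hs', Or.inr e⟩⟩
    have n2 := n1 i (by omega)
    have n3 := n1 j hm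
    rcases cases3 p with rfl | rfl | ⟨h1, h2⟩
    · omega
    · omega
    · rw [h.of_ne p h1 h2] at hp
      omega

theorem Reach.ascent {n m : ℕ} {L : List (PosRoot n)} {u v : SignedPerm n} (h : Reach L u v)
    (hL : ∀ α ∈ L, α.IsPlusBelow m) : Ascent m (val u) (val v) := by
  induction h with
  | nil u => exact .refl m _
  | skip α _ ih => exact ih fun β hβ => hL β (List.mem_cons_of_mem _ hβ)
  | take e _ ih =>
    obtain ⟨i, j, hij, rfl, hj⟩ := hL _ List.mem_cons_self
    exact (((qbEdge_plus_iff _ _ hij).1 e).2.ascent hj).trans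
      (ih fun β hβ => hL β (List.mem_cons_of_mem _ hβ))

/-! ### Paths inside one segment -/

theorem Reach.segment_fix {n j : ℕ} {i : Fin n} {u v : SignedPerm n}
    (h : Reach (segment i j) u v) {p : Fin n} (hp : j ≤ p.1) (hpi : p ≠ i) : val v p = val u p := by
  induction j generalizing u with
  | zero =>
    cases h
    rfl
  | succ j ih =>
    by_cases hj : j < i.1
    · rw [segment_succ i hj] at h
      cases h with
      | skip _ h => exact ih h (by omega)
      | take e h =>
        rw [ih h (by omega)]
        refine ((qbEdge_plus_iff _ _ _).1 e).2.of_ne p ?_ hpi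
        rintro rfl
        simp at hp
    · simp only [segment, hj, dif_neg, not_false_eq_true] at h
      exact ih h (by omega)

/-- A value of the position `q` between the bars of the final and of the initial values at `i`
cannot be skipped. -/
theorem Reach.segment_not_skip {n j : ℕ} {i : Fin n} {u v : SignedPerm n} (hji : j ≤ i.1)
    (h : Reach (segment i j) u v) {q : Fin n} (hq : j ≤ q.1) (hqi : q < i) :
    ¬ (val u q + val u i + 1 < 2 * n ∧ 2 * n ≤ val u q + val v i + 1) := by
  induction j generalizing u with
  | zero =>
    cases h
    omega
  | succ j ih =>
    rw [segment_succ i hji] at h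
    cases h with
    | skip _ h => exact ih (by omega) h (by omega)
    | take e h =>
      have hs := ((qbEdge_plus_iff _ _ _).1 e).2
      have h1 := ih (by omega) h (by omega)
      have hne : q ≠ ⟨j, Nat.lt_trans hji i.2⟩ := by
        rintro rfl
        simp at hq
      have h2 := hs.of_ne q hne hqi.ne
      have h3 := hs.between q (by simp only [Fin.lt_def]; omega) hqi
      have h4 := hs.left
      have h5 := hs.right
      have h6 : val u q ≠ val u ⟨j, Nat.lt_trans hji i.2⟩ := fun e => hne (val_injective u e)
      rw [h2] at h1
      omega

/-- A position `p < i` moves at most once, from the bar of the new entry at `i` to the bar of the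
old one; the climb of `i` gives the two bounds. For `p < l < i`, the entry at `l` is already final
when `p` moves: `between` keeps it out of the jump of `p`, and `Reach.segment_not_skip` keeps its
bar out of the rest of the climb of `i`. -/
theorem Reach.segment_changed {n j : ℕ} {i : Fin n} {u v : SignedPerm n} (hji : j ≤ i.1)
    (h : Reach (segment i j) u v) {p : Fin n} (hpi : p < i) (hp : val u p < val v p) :
    2 * n ≤ val u p + val v i + 1 ∧ val v p + val u i + 1 ≤ 2 * n ∧
      ∀ l, p < l → l < i → ¬ (2 * n ≤ val v l + val v i + 1 ∧ val v l < val v p) := by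
  induction j generalizing u with
  | zero =>
    cases h
    omega
  | succ j ih =>
    rw [segment_succ i hji] at h
    cases h with
    | skip _ h => exact ih (by omega) h hp
    | @take _ _ w _ _ e h =>
      have hs := ((qbEdge_plus_iff _ _ _).1 e).2
      have hA := h.ascent (m := i.1 + 1) fun α hα => isPlusBelow_of_mem_segment hα (by omega)
      have h4 := hs.left
      have h5 := hs.right
      have h6 := hs.val_lt_val
      have h7 := hA.mono i
      by_cases hpj : p = ⟨j, Nat.lt_trans hji i.2⟩
      · subst hpj
        have h8 := h.segment_fix (p := ⟨j, Nat.lt_trans hji i.2⟩) le_rfl (Fin.ne_of_lt hpi)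
        refine ⟨by omega, by omega, fun l hl hli => ?_⟩
        have hl' : j < l.1 := hl
        have h9 := h.segment_fix (p := l) (by omega) hli.ne
        have h10 := hs.of_ne l hl.ne' hli.ne
        have h11 := hs.between l hl hli
        have h12 := h.segment_not_skip (by omega) (q := l) (by omega) hli
        have h13 : val u l ≠ val u ⟨j, Nat.lt_trans hji i.2⟩ := fun e => hl.ne' (val_injective u e)
        omega
      · have h8 := hs.of_ne p hpj hpi.ne
        have h9 := ih (by omega) h (by omega)
        refine ⟨by omega, by omega, h9.2.2⟩

/-! ### Uniqueness of the path -/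

/-- Two paths cannot first differ in whether they use the root `(j, i)`. Using it brings the entry
at `i` to the bar of `u(j)` or higher; declining it forbids ever reaching that bar, by
`Reach.segment_not_skip`. Since the entry at `i` is final after the segment, the endpoints would
differ there. -/
theorem path_unique {n : ℕ} {i : ℕ} {hi : i ≤ n} {u : SignedPerm n}
    {P Q : List (PosRoot n × SignedPerm n)} (hP : IsQBPath u P) (hQ : IsQBPath u Q)
    (hPL : (labels P).Sublist (revGamma n i)) (hQL : (labels Q).Sublist (revGamma n i))
    (hPQ : ∀ p : Fin n, p.1 < i → val (endpoint u P) p = val (endpoint u Q) p) : P = Q := by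
  induction i generalizing u P Q with
  | zero =>
    have h1 : P = [] := by simpa [labels, revGamma] using hPL
    have h2 : Q = [] := by simpa [labels, revGamma] using hQL
    rw [h1, h2]
  | succ i IH =>
    rw [revGamma_succ hi] at hPL hQL
    suffices H : ∀ (j : ℕ) (_ : j ≤ i) (u : SignedPerm n) (P Q : List (PosRoot n × SignedPerm n)),
        IsQBPath u P → IsQBPath u Q →
        (labels P).Sublist (segment ⟨i, hi⟩ j ++ revGamma n i) →
        (labels Q).Sublist (segment ⟨i, hi⟩ j ++ revGamma n i) →
        (∀ p : Fin n, p.1 < i + 1 → val (endpoint u P) p = val (endpoint u Q) p) → P = Q from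
      H i le_rfl u P Q hP hQ hPL hQL hPQ
    clear hP hQ hPL hQL hPQ u P Q
    intro j hj
    induction j with
    | zero =>
      intro u P Q hP hQ hPL hQL hPQ
      exact IH (hi := by omega) hP hQ hPL hQL fun p hp => hPQ p (by omega)
    | succ j ih =>
      have key : ∀ (u : SignedPerm n) (P Q : List (PosRoot n × SignedPerm n)),
          IsQBPath u P → IsQBPath u Q →
          (labels P).Sublist (segment ⟨i, hi⟩ j ++ revGamma n i) →
          (∃ w Q', Q = (PosRoot.plus ⟨j, by omega⟩ ⟨i, hi⟩ hj, w) :: Q' ∧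
            (labels Q').Sublist (segment ⟨i, hi⟩ j ++ revGamma n i)) →
          val (endpoint u P) ⟨i, hi⟩ = val (endpoint u Q) ⟨i, hi⟩ → False := by
        rintro u P Q hP hQ hPL ⟨w, Q', rfl, hQL⟩ hPQ
        have hs := ((qbEdge_plus_iff _ _ _).1 hQ.1).2
        have r1 := reach_of_path hP hPL
        have r2 := (reach_of_path hQ.2 hQL).ascent (m := i + 1) (by
          intro α hα
          rcases List.mem_append.1 hα with h | h
          · exact isPlusBelow_of_mem_segment h (by simp)
          · obtain ⟨a, b, hab, rfl, hb⟩ := isPlusBelow_of_mem_revGamma h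
            exact ⟨a, b, hab, rfl, by omega⟩)
        obtain ⟨v, r3, r4⟩ := reach_append_iff.1 r1
        have r5 := (r4.ascent fun α => isPlusBelow_of_mem_revGamma).fix ⟨i, hi⟩ le_rfl
        have r6 := r3.segment_not_skip (by simp only; omega) (q := ⟨j, by omega⟩) le_rfl hj
        have r7 := r2.mono ⟨i, hi⟩
        rw [endpoint_cons] at hPQ
        have h4 := hs.left
        have h5 := hs.right
        have h6 := hs.val_lt_val
        simp only at hPQ
        omega
      intro u P Q hP hQ hPL hQL hPQ
      rw [segment_succ _ hj, List.cons_append] at hPL hQL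
      have aux : ∀ (P : List (PosRoot n × SignedPerm n)) (L : List (PosRoot n)),
          (labels P).Sublist (PosRoot.plus ⟨j, by omega⟩ ⟨i, hi⟩ hj :: L) →
          (labels P).Sublist L ∨ ∃ w P', P = (PosRoot.plus ⟨j, by omega⟩ ⟨i, hi⟩ hj, w) :: P' ∧
            (labels P').Sublist L := by
        intro P L hPL
        rcases List.sublist_cons_iff.1 hPL with h | ⟨r, hr, h⟩
        · exact Or.inl h
        · right
          match P, hr with
          | (β, w) :: P, hr =>
            simp only [labels, List.map_cons, List.cons.injEq] at hr
            obtain ⟨rfl, rfl⟩ := hr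
            exact ⟨w, P, rfl, h⟩
      rcases aux P _ hPL with h1 | h1 <;> rcases aux Q _ hQL with h2 | h2
      · exact ih (by omega) u P Q hP hQ h1 h2 hPQ
      · exact (key u P Q hP hQ h1 h2 (hPQ _ (by simp))).elim
      · exact (key u Q P hQ hP h2 h1 (hPQ _ (by simp)).symm).elim
      · obtain ⟨w, P', rfl, h1⟩ := h1
        obtain ⟨w', Q', rfl, h2⟩ := h2
        have e1 := hP.1.1
        have e2 := hQ.1.1
        rw [← e1] at e2
        subst e2
        simp only [endpoint_cons] at hPQ
        rw [ih (by omega) w' P' Q' hP.2 hQ.2 h1 h2 hPQ]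

/-! ### Monotonicity along a path and necessity of the circular condition -/

theorem path_monotone {n m : ℕ} {u : SignedPerm n} {P : List (PosRoot n × SignedPerm n)}
    (hP : IsQBPath u P) (hL : ∀ α ∈ labels P, α.IsPlusBelow m) (p : Fin n) :
    ((vertices u P).Pairwise fun v w => val v p ≤ val w p) ∧
      ∀ w ∈ vertices u P, val u p ≤ val w p ∧ (val u p < n ↔ val w p < n) := by
  induction P generalizing u with
  | nil => simp [vertices]
  | cons x P ih =>
    obtain ⟨α, w⟩ := x
    have hv : vertices u ((α, w) :: P) = u :: vertices w P := rfl
    obtain ⟨i, j, hij, rfl, hj⟩ := hL α (by simp [labels])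
    have hA := ((qbEdge_plus_iff _ _ _).1 hP.1).2.ascent hj
    obtain ⟨h1, h2⟩ := ih hP.2 fun α hα => hL α (List.mem_cons_of_mem _ hα)
    have h3 : ∀ v ∈ vertices w P, val u p ≤ val v p ∧ (val u p < n ↔ val v p < n) :=
      fun v hv' => ⟨(hA.mono p).trans (h2 v hv').1, (hA.side p).trans (h2 v hv').2⟩
    rw [hv]
    refine ⟨List.pairwise_cons.2 ⟨fun v hv' => (h3 v hv').1, h1⟩, fun v hv' => ?_⟩
    rcases List.mem_cons.1 hv' with rfl | hv'
    · exact ⟨le_rfl, Iff.rfl⟩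
    · exact h3 v hv'

theorem not_inAbs_val {n m : ℕ} {w : SignedPerm n} {q : Fin n} (hq : m ≤ q.1) {y : ℕ}
    (h : val w q = y ∨ val w q + y + 1 = 2 * n) : ¬ InAbs m (val w) y := by
  rintro ⟨p, hp, h'⟩
  have h1 := val_add_val_ne w p q
  have h2 : val w p ≠ val w q := fun e => by
    have := val_injective w e
    subst this
    omega
  omega

/-- A path preserves the linear form of the circular condition on pairs of columns. -/
theorem Reach.not_between {n k : ℕ} (hk : k ≤ n) {u v : SignedPerm n}
    (h : Reach (revGamma n k) u v) {i l : Fin n} (hil : i < l) (hl : l.1 < k) :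
    ¬ (val u i ≤ val v l ∧ val v l < val v i) := by
  induction k generalizing u with
  | zero => omega
  | succ k ih =>
    rw [revGamma_succ hk] at h
    obtain ⟨w, h1, h2⟩ := reach_append_iff.1 h
    have hA1 := h1.ascent (m := k + 1) fun α hα => isPlusBelow_of_mem_segment hα (by simp)
    have hA2 := h2.ascent fun α => isPlusBelow_of_mem_revGamma
    have hfix := hA2.fix ⟨k, hk⟩ le_rfl
    have hil' : i.1 < l.1 := hil
    have hw := val_lt w ⟨k, hk⟩
    have m1 := hA1.mono i
    have s1 := hA1.side i
    have hch := fun hp => h1.segment_changed (p := i) le_rfl (by simp only [Fin.lt_def]; omega) hp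
    rintro ⟨b1, b2⟩
    by_cases hlk : l = ⟨k, hk⟩
    · subst hlk
      have s2 := hA2.side i
      have s3 := hA1.side ⟨k, hk⟩
      have hne : val w i ≠ val w ⟨k, hk⟩ := fun e => hil.ne (val_injective w e)
      have hc := hA2.not_cross (val w ⟨k, hk⟩) hw (not_inAbs_val (q := ⟨k, hk⟩) le_rfl (Or.inl rfl)) i
      -- If `i` moved in the first segment, the bounds in `hch` are incompatible with the preserved
      -- sides. Otherwise `i` would have to cross `w(k)` later, although that absolute value has
      -- left the active positions.
      rcases Nat.lt_or_ge (val u i) (val w i) with h3 | h3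
      · have h4 := hch h3
        omega
      · omega
    · have hlk' : l.1 < k := by
        have : l.1 ≠ k := fun e => hlk (Fin.ext e)
        omega
      have h3 := ih (by omega) h2 hlk'
      have h4 := hch (by omega)
      have h5 := h4.2.2 l hil hlk'
      have m2 := hA2.mono l
      -- By `h3` and `h5`, after the segment the entry at `l` is below the bar of `w(k)`; its final
      -- value is at least `u(i)`, hence at least that bar. So `l` would cross a letter that is no
      -- longer active.
      have hc := hA2.not_cross (2 * n - 1 - val w ⟨k, hk⟩) (by omega)
        (not_inAbs_val (q := ⟨k, hk⟩) le_rfl (Or.inr (by omega))) l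
      omega

/-! ### Counting entries above a threshold -/

/-- The number of the first `m` values of `f` that are at least `y`. -/
def cnt {n : ℕ} (m : ℕ) (f : Fin n → ℕ) (y : ℕ) : ℕ :=
  (Finset.univ.filter fun p : Fin n => p.1 < m ∧ y ≤ f p).card

theorem cnt_le {n m : ℕ} {f g : Fin n → ℕ} {y : ℕ}
    (h : ∀ p : Fin n, p.1 < m → ¬ (f p < y ∧ y ≤ g p)) : cnt m g y ≤ cnt m f y := by
  refine Finset.card_le_card fun p => ?_
  simp only [Finset.mem_filter, Finset.mem_univ, true_and]
  have := h p
  omega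

theorem cnt_lt {n m : ℕ} {f g : Fin n → ℕ} {y : ℕ}
    (h : ∀ p : Fin n, p.1 < m → ¬ (f p < y ∧ y ≤ g p)) {q : Fin n} (hq : q.1 < m)
    (h1 : g q < y) (h2 : y ≤ f q) : cnt m g y < cnt m f y := by
  refine Finset.card_lt_card ((Finset.ssubset_iff_of_subset ?_).2 ⟨q, ?_, ?_⟩)
  · intro p
    simp only [Finset.mem_filter, Finset.mem_univ, true_and]
    have := h p
    omega
  · simp [hq, h2]
  · simp [h1]

/-- The first `m` values of `f` are letters with pairwise distinct absolute values. -/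
structure IsCol {n : ℕ} (m : ℕ) (f : Fin n → ℕ) : Prop where
  lt : ∀ p, f p < 2 * n
  inj : ∀ p q : Fin n, p.1 < m → q.1 < m → f p = f q → p = q
  add_ne : ∀ p q : Fin n, p.1 < m → q.1 < m → f p + f q + 1 ≠ 2 * n

theorem IsCol.mono {n m m' : ℕ} {f : Fin n → ℕ} (h : IsCol m f) (hm : m' ≤ m) : IsCol m' f :=
  ⟨h.lt, fun p q hp hq => h.inj p q (by omega) (by omega),
    fun p q hp hq => h.add_ne p q (by omega) (by omega)⟩

theorem isCol_val {n : ℕ} (m : ℕ) (w : SignedPerm n) : IsCol m (val w) :=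
  ⟨val_lt w, fun _ _ _ _ h => val_injective w h, fun p q _ _ => val_add_val_ne w p q⟩

-- The active letters, with their bars, that are at least `y` come from entries `≥ y` and from bars
-- of entries `< 2n - y`. These are disjoint families because the absolute values are distinct.
open Classical in
theorem IsCol.cnt_add {n m : ℕ} {f : Fin n → ℕ} (h : IsCol m f) {y : ℕ} (hy : y ≤ 2 * n) :
    cnt m f y + (Finset.univ.filter fun p : Fin n => p.1 < m).card =
      cnt m f (2 * n - y) + ((Finset.Ico y (2 * n)).filter fun v => InAbs m f v).card := by
  have h1 : (Finset.univ.filter fun p : Fin n => p.1 < m).card = cnt m f (2 * n - y) +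
      (Finset.univ.filter fun p : Fin n => p.1 < m ∧ ¬ 2 * n - y ≤ f p).card := by
    unfold cnt
    rw [← Finset.filter_filter, ← Finset.filter_filter]
    exact (Finset.card_filter_add_card_filter_not _).symm
  have h2 : (Finset.Ico y (2 * n)).filter (fun v => InAbs m f v) =
      (Finset.univ.filter fun p : Fin n => p.1 < m ∧ y ≤ f p).image f ∪
      (Finset.univ.filter fun p : Fin n => p.1 < m ∧ ¬ 2 * n - y ≤ f p).image
        (fun p => 2 * n - 1 - f p) := by
    ext v
    simp only [Finset.mem_filter, Finset.mem_Ico, Finset.mem_union, Finset.mem_image,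
      Finset.mem_univ, true_and]
    constructor
    · rintro ⟨hv, q, hq, hqv | hqv⟩
      · exact Or.inl ⟨q, ⟨hq, by omega⟩, hqv⟩
      · exact Or.inr ⟨q, ⟨hq, by omega⟩, by omega⟩
    · rintro (⟨q, ⟨hq, h1⟩, rfl⟩ | ⟨q, ⟨hq, h1⟩, rfl⟩)
      · exact ⟨⟨h1, h.lt q⟩, q, hq, Or.inl rfl⟩
      · have := h.lt q
        exact ⟨by omega, q, hq, Or.inr (by omega)⟩
  rw [h1, h2, Finset.card_union_of_disjoint, Finset.card_image_of_injOn,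
    Finset.card_image_of_injOn]
  · unfold cnt
    omega
  · intro p hp q hq hpq
    simp only [Finset.coe_filter, Finset.mem_univ, true_and, Set.mem_ofPred_eq] at hp hq hpq
    have := h.lt p
    have := h.lt q
    exact h.inj p q hp.1 hq.1 (by omega)
  · intro p hp q hq hpq
    simp only [Finset.coe_filter, Finset.mem_univ, true_and, Set.mem_ofPred_eq] at hp hq
    exact h.inj p q hp.1 hq.1 hpq
  · rw [Finset.disjoint_left]
    simp only [Finset.mem_image, Finset.mem_filter, Finset.mem_univ, true_and]
    rintro v ⟨p, ⟨hp, -⟩, rfl⟩ ⟨q, ⟨hq, -⟩, hpq⟩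
    have := h.add_ne p q hp hq
    have := h.lt q
    omega

/-- By `IsCol.cnt_add`, the difference of the counts at `y` and `2n - y` depends only on the set of
absolute values. Hence an excess of `g` over `f` at one threshold is the same excess at the mirror
threshold. -/
theorem cnt_symm {n m : ℕ} {f g : Fin n → ℕ} (hf : IsCol m f) (hg : IsCol m g)
    (hfg : ∀ y, InAbs m f y ↔ InAbs m g y) {y : ℕ} (hy : y ≤ 2 * n) :
    cnt m f y + cnt m g (2 * n - y) = cnt m g y + cnt m f (2 * n - y) := by
  classical
  have h1 := hf.cnt_add hy
  have h2 := hg.cnt_add hy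
  have h3 : (Finset.Ico y (2 * n)).filter (fun v => InAbs m f v) =
      (Finset.Ico y (2 * n)).filter (fun v => InAbs m g v) :=
    Finset.filter_congr fun v _ => hfg v
  rw [h3] at h1
  omega

theorem Step.cnt_eq {n m : ℕ} {w w' : SignedPerm n} {i j : Fin n} (h : Step w i j w')
    (hm : j.1 < m) (y : ℕ) :
    cnt m (val w') y = cnt m (val w) y + (if val w i < y ∧ y ≤ val w' i then 1 else 0) +
      (if val w j < y ∧ y ≤ val w' j then 1 else 0) := by
  have hij : i.1 < j.1 := h.lt
  have key : ∀ f : Fin n → ℕ, cnt m f y = (if y ≤ f i then 1 else 0) + ((if y ≤ f j then 1 else 0) +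
      ∑ p ∈ (Finset.univ.erase i).erase j, if p.1 < m ∧ y ≤ f p then 1 else 0) := by
    intro f
    rw [cnt, Finset.card_filter, ← Finset.add_sum_erase _ _ (Finset.mem_univ i),
      ← Finset.add_sum_erase _ _ (Finset.mem_erase.2 ⟨h.lt.ne', Finset.mem_univ j⟩)]
    simp only [hm, hij.trans hm, true_and]
  have hs : ∑ p ∈ (Finset.univ.erase i).erase j, (if p.1 < m ∧ y ≤ val w' p then 1 else 0) =
      ∑ p ∈ (Finset.univ.erase i).erase j, (if p.1 < m ∧ y ≤ val w p then 1 else 0) := by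
    refine Finset.sum_congr rfl fun p hp => ?_
    simp only [Finset.mem_erase, Finset.mem_univ, and_true] at hp
    rw [h.of_ne p hp.2 hp.1]
  rw [key, key, hs]
  have h1 := h.left
  have h2 := h.right
  have h3 := h.val_lt_val
  generalize (∑ p ∈ (Finset.univ.erase i).erase j, (if p.1 < m ∧ y ≤ val w p then 1 else 0)) = s
  split_ifs <;> omega

/-- The climbs of `i` are consecutive intervals, and each partner climbs through the mirror image of
the corresponding one. The counts therefore telescope and depend only on the initial and final
entries at `i`. -/
theorem Reach.segment_cnt {n m j : ℕ} {i : Fin n} {u v : SignedPerm n} (hji : j ≤ i.1)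
    (hm : i.1 < m) (h : Reach (segment i j) u v) (y : ℕ) :
    cnt m (val v) y = cnt m (val u) y +
      (if 2 * n ≤ val v i + y ∧ y + val u i + 1 ≤ 2 * n then 1 else 0) +
      (if val u i < y ∧ y ≤ val v i then 1 else 0) := by
  induction j generalizing u with
  | zero =>
    cases h
    rw [if_neg (by omega), if_neg (by omega), add_zero, add_zero]
  | succ j ih =>
    rw [segment_succ i hji] at h
    cases h with
    | skip _ h => exact ih (by omega) h
    | @take _ _ w _ _ e h =>
      have hs := ((qbEdge_plus_iff _ _ _).1 e).2
      have hA := h.ascent fun α hα => isPlusBelow_of_mem_segment hα hm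
      rw [ih (by omega) h, hs.cnt_eq hm]
      have h1 := hs.left
      have h2 := hs.right
      have h3 := hs.val_lt_val
      have h4 := hA.mono i
      generalize val u ⟨j, _⟩ = a at *
      generalize val w ⟨j, _⟩ = b at *
      split_ifs <;> omega

/-! ### Greedy construction of a path -/

theorem inAbs_bar {n m : ℕ} {f : Fin n → ℕ} (hf : ∀ p, f p < 2 * n) {y : ℕ} (hy : y < 2 * n) :
    InAbs m f (2 * n - 1 - y) ↔ InAbs m f y := by
  constructor
  · rintro ⟨q, hq, h⟩
    have := hf q
    exact ⟨q, hq, by omega⟩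
  · rintro ⟨q, hq, h⟩
    have := hf q
    exact ⟨q, hq, by omega⟩

theorem exists_qbEdge {n : ℕ} (u : SignedPerm n) {i j : Fin n} (h : i < j)
    (hlt : val u i + val u j + 1 < 2 * n) (hside : val u i < n ↔ n ≤ val u j)
    (between : ∀ m, i < m → m < j → ¬ (val u i < val u m ∧ val u m + val u j + 1 < 2 * n))
    (beyond : ∀ m, j < m → ¬ (val u i < val u m ∧ val u m + val u j + 1 < 2 * n) ∧
      ¬ (val u j < val u m ∧ val u m + val u i + 1 < 2 * n)) :
    ∃ w, QBEdge u (.plus i j h) w ∧ Step u i j w := by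
  have h1 := val_mul_refl_left u h
  have h2 := val_mul_refl_right u h
  have hs : Step u i j (u * (PosRoot.plus i j h).refl) := by
    refine ⟨h, h1, h2, fun m => val_mul_refl_of_ne u h, by omega, by omega, fun m ha hb => ?_,
      fun m ha => ?_⟩
    · have := between m ha hb
      omega
    · have := beyond m ha
      omega
  exact ⟨_, (qbEdge_plus_iff _ _ h).2 ⟨rfl, hs⟩, hs⟩

/-- Greedy construction of a segment of a path that changes the value at `i` towards `z`. -/
theorem exists_reach_segment {n j : ℕ} {i : Fin n} (hji : j ≤ i.1) {z : ℕ} (u : SignedPerm n)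
    (hle : val u i ≤ z) (hside : val u i < n ↔ z < n)
    (hskip : ∀ p : Fin n, j ≤ p.1 → p < i →
      ¬ (2 * n ≤ val u p + z + 1 ∧ val u p + val u i + 1 < 2 * n))
    (habs : ∀ y, 2 * n ≤ y + z + 1 → y + val u i + 1 ≤ 2 * n → InAbs (i.1 + 1) (val u) y) :
    ∃ w, Reach (segment i j) u w ∧ val w i ≤ z ∧
      ∀ p : Fin n, p < i → ¬ (2 * n ≤ val w p + z + 1 ∧ val w p + val w i + 1 < 2 * n) := by
  induction j generalizing u with
  | zero => exact ⟨u, .nil u, hle, fun p => hskip p (Nat.zero_le _)⟩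
  | succ j ih =>
    rw [segment_succ i hji]
    set q : Fin n := ⟨j, by omega⟩ with hq
    -- The root is taken exactly when the bar of the entry at `q` lies above the current entry at
    -- `i` and does not exceed the target `z`.
    by_cases hc : 2 * n ≤ val u q + z + 1 ∧ val u q + val u i + 1 < 2 * n
    -- By `habs`, every letter from `z̄` to the bar of the current entry at `i` has its absolute
    -- value at a position up to `i`. Nothing beyond `i` can obstruct the edge; positions between
    -- `q` and `i` are handled by `hskip`.
    · have hpos : ∀ m, i < m → ∀ y, (val u m = y ∨ val u m + y + 1 = 2 * n) →
          ¬ (2 * n ≤ y + z + 1 ∧ y + val u i + 1 ≤ 2 * n) := by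
        intro m hm y hy hy'
        exact not_inAbs_val hm hy (habs y hy'.1 hy'.2)
      obtain ⟨w, he, hs⟩ := exists_qbEdge u (i := q) (j := i) hji hc.2 (by omega)
        (fun m ha hb => by
          have ha' : j < m.1 := ha
          have := hskip m ha' hb
          omega)
        (fun m ha => by
          have h1 := hpos m ha (val u m) (Or.inl rfl)
          have h2 := hpos m ha (2 * n - 1 - val u m) (Or.inr (by have := val_lt u m; omega))
          omega)
      have h1 := hs.left
      have h2 := hs.right
      have hA := hs.ascent (m := i.1 + 1) (by omega)
      have h3 := hA.side i
      obtain ⟨v, hv1, hv2⟩ := ih (by omega) w (by omega) (by omega)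
        (fun p hp hpi => by
          by_cases hpq : p = q
          · subst hpq
            omega
          · have hp' : p.1 ≠ j := fun e => hpq (Fin.ext e)
            have := hskip p (by omega) hpi
            rw [hs.of_ne p hpq hpi.ne]
            omega)
        (fun y hy1 hy2 => (hA.inAbs y).1 (habs y hy1 (by omega)))
      exact ⟨v, .take he hv1, hv2⟩
    · obtain ⟨v, hv1, hv2⟩ := ih (by omega) u hle hside
        (fun p hp hpi => by
          by_cases hpq : p = q
          · rw [hpq]
            exact hc
          · have hp' : p.1 ≠ j := fun e => hpq (Fin.ext e)
            exact hskip p (by omega) hpi) habs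
      exact ⟨v, .skip _ hv1, hv2⟩

theorem inAbs_succ {n k : ℕ} (hk : k < n) (f : Fin n → ℕ) (y : ℕ) :
    InAbs (k + 1) f y ↔
      InAbs k f y ∨ (f ⟨k, hk⟩ = y ∨ f ⟨k, hk⟩ + y + 1 = 2 * n) := by
  constructor
  · rintro ⟨q, hq, h⟩
    by_cases hqk : q.1 = k
    · right
      have : q = ⟨k, hk⟩ := Fin.ext hqk
      rwa [← this]
    · exact Or.inl ⟨q, by omega, h⟩
  · rintro (⟨q, hq, h⟩ | h)
    · exact ⟨q, by omega, h⟩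
    · exact ⟨⟨k, hk⟩, by simp, h⟩

theorem IsCol.not_inAbs {n k : ℕ} (hk : k < n) {f : Fin n → ℕ} (h : IsCol (k + 1) f) {y : ℕ}
    (hy : f ⟨k, hk⟩ = y ∨ f ⟨k, hk⟩ + y + 1 = 2 * n) : ¬ InAbs k f y := by
  rintro ⟨q, hq, h'⟩
  have h1 := h.add_ne q ⟨k, hk⟩ (by omega) (by simp)
  have h2 : f q ≠ f ⟨k, hk⟩ := fun e => by
    have := h.inj q ⟨k, hk⟩ (by omega) (by simp) e
    rw [this] at hq
    simp at hq
  omega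

/-- If the greedy climb stopped below the target `c(k)`, that letter or its bar would sit at some `q
< k`. The bar is excluded, as it would be a usable partner left over. The letter itself cannot have
arrived at `q` during the segment, because of the sides; if it was there from the start, the
condition on `q < k` fails. -/
theorem exists_segment_to {n k : ℕ} (hk : k < n) {u : SignedPerm n} {c : Fin n → ℕ}
    (hc : IsCol (k + 1) c) (hA : Ascent (k + 1) (val u) c)
    (hcond : ∀ i l : Fin n, i < l → l.1 < k + 1 → ¬ (val u i ≤ c l ∧ c l < c i)) :
    ∃ w, Reach (segment ⟨k, hk⟩ k) u w ∧ val w ⟨k, hk⟩ = c ⟨k, hk⟩ := by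
  have hm := hA.mono ⟨k, hk⟩
  have hs := hA.side ⟨k, hk⟩
  have hz := hc.lt ⟨k, hk⟩
  have habs : ∀ y, 2 * n ≤ y + c ⟨k, hk⟩ + 1 → y + val u ⟨k, hk⟩ + 1 ≤ 2 * n →
      InAbs (k + 1) (val u) y := by
    intro y h1 h2
    by_contra hn
    have hn1 : ¬ (val u ⟨k, hk⟩ = 2 * n - 1 - y) := fun e =>
      hn ⟨⟨k, hk⟩, by simp, by omega⟩
    have hn2 : ¬ (c ⟨k, hk⟩ = 2 * n - 1 - y) := fun e =>
      hn ((hA.inAbs y).2 ⟨⟨k, hk⟩, by simp, by omega⟩)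
    rw [← inAbs_bar (val_lt u) (by omega)] at hn
    have := hA.not_cross _ (by omega) hn ⟨k, hk⟩
    omega
  obtain ⟨w, hw, hw1, hw2⟩ := exists_reach_segment (i := ⟨k, hk⟩) (j := k) le_rfl
    (z := c ⟨k, hk⟩) u hm hs
    (fun p hp hpi => absurd hpi (by simp only [Fin.lt_def]; omega)) habs
  refine ⟨w, hw, ?_⟩
  by_contra hne
  have hAw := hw.ascent (m := k + 1) fun α hα => isPlusBelow_of_mem_segment hα (by simp)
  have m1 := hAw.mono ⟨k, hk⟩
  have s1 := hAw.side ⟨k, hk⟩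
  obtain ⟨q, hq, hqe⟩ := (hAw.inAbs _).1 (habs (2 * n - 1 - c ⟨k, hk⟩) (by omega) (by omega))
  by_cases hqk : q = ⟨k, hk⟩
  · subst hqk
    omega
  · have hq' : q.1 < k := by
      have : q.1 ≠ k := fun e => hqk (Fin.ext e)
      omega
    have h1 := hw2 q hq'
    have m2 := hAw.mono q
    have s2 := hAw.side q
    rcases Nat.lt_or_ge (val u q) (val w q) with h2 | h2
    · have h3 := hw.segment_changed le_rfl (p := q) hq' h2
      omega
    · have h3 := hcond q ⟨k, hk⟩ hq' (by simp)
      have h4 := hA.mono q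
      have h5 : c q ≠ c ⟨k, hk⟩ := fun e => hqk (hc.inj q _ hq (by simp) e)
      omega

/-- The entries at positions below `k` may have been raised too far by the segment. Counts at a
threshold exclude this: the segment only uses excess that the target has over `u`, and an
overshooting entry would create a deficit that no other entry can compensate. -/
theorem Ascent.after_segment {n k : ℕ} (hk : k < n) {u w : SignedPerm n} {c : Fin n → ℕ}
    (hc : IsCol (k + 1) c) (hA : Ascent (k + 1) (val u) c)
    (hcond : ∀ i l : Fin n, i < l → l.1 < k + 1 → ¬ (val u i ≤ c l ∧ c l < c i))
    (hw : Reach (segment ⟨k, hk⟩ k) u w) (hwk : val w ⟨k, hk⟩ = c ⟨k, hk⟩) :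
    Ascent k (val w) c := by
  have hAw := hw.ascent (m := k + 1) fun α hα => isPlusBelow_of_mem_segment hα (by simp)
  have hz := hc.lt ⟨k, hk⟩
  have mk := hAw.mono ⟨k, hk⟩
  have sk := hAw.side ⟨k, hk⟩
  have hsym : ∀ y, y ≤ 2 * n → _ := fun y hy => cnt_symm (isCol_val (k + 1) u) hc hA.inAbs hy
  have hle : ∀ y, cnt (k + 1) (val u) y ≤ cnt (k + 1) c y := fun y =>
    cnt_le fun p _ => by
      have := hA.mono p
      omega
  have hltz : ∀ y, val u ⟨k, hk⟩ < y → y ≤ c ⟨k, hk⟩ →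
      cnt (k + 1) (val u) y < cnt (k + 1) c y := fun y h1 h2 =>
    cnt_lt (fun p _ => by
      have := hA.mono p
      omega) (q := ⟨k, hk⟩) (by simp) h1 h2
  -- The segment adds one to the count for `y` in the climb of `k` or in its mirror image. Position
  -- `k` itself gives the target an excess on the former, and `hsym` gives it on the latter. The two
  -- ranges are disjoint, as the climb stays on one side.
  have hcw : ∀ y, y ≤ 2 * n → cnt (k + 1) (val w) y ≤ cnt (k + 1) c y := by
    intro y hy
    have h1 := hw.segment_cnt (m := k + 1) le_rfl (by simp) y
    have h2 := hle y
    have h3 := hltz y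
    have h4 := hltz (2 * n - y)
    have h5 := hsym y hy
    split_ifs at h1 <;> omega
  -- No entry rises past the threshold `c(k) + 1`: the condition with `l = k` forbids it for `p <
  -- k`. The target thus has no excess there, nor at the mirror threshold, which is the bar of
  -- `c(k)`; so no entry crosses that bar.
  have hcross : ∀ p : Fin n, p.1 < k + 1 →
      ¬ (val u p + c ⟨k, hk⟩ + 1 < 2 * n ∧ 2 * n ≤ c p + c ⟨k, hk⟩ + 1) := by
    intro p hp hpc
    have h1 : cnt (k + 1) c (c ⟨k, hk⟩ + 1) ≤ cnt (k + 1) (val u) (c ⟨k, hk⟩ + 1) := by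
      refine cnt_le fun q hq => ?_
      by_cases hqk : q = ⟨k, hk⟩
      · subst hqk
        omega
      · have hq' : q.1 < k := by
          have : q.1 ≠ k := fun e => hqk (Fin.ext e)
          omega
        have := hcond q ⟨k, hk⟩ hq' (by simp)
        omega
    have h2 := hsym (c ⟨k, hk⟩ + 1) (by omega)
    have h3 : cnt (k + 1) (val u) (2 * n - (c ⟨k, hk⟩ + 1)) <
        cnt (k + 1) c (2 * n - (c ⟨k, hk⟩ + 1)) :=
      cnt_lt (fun p _ => by
        have := hA.mono p
        omega) (q := p) hp (by omega) (by omega)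
    omega
  have hmono : ∀ p, val w p ≤ c p := by
    intro i
    by_contra hlt
    have mi := hA.mono i
    have hik : i.1 < k := by
      by_contra h'
      rcases Nat.lt_or_ge k i.1 with h | h
      · rw [hA.fix i h, hAw.fix i h] at hlt
        exact hlt le_rfl
      · have : i = ⟨k, hk⟩ := Fin.ext (by simp only; omega)
        subst this
        omega
    have hch := hw.segment_changed le_rfl (p := i) hik (by omega)
    -- Position `i` falls past the threshold `c(i) + 1` on the way from `w` to `c`, so some `p` must
    -- rise past it. For `p < i` the condition on `(p, i)` forbids this; for `i < p < k`,
    -- `segment_changed` would force `p` to cross the bar of `c(k)`.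
    have h1 := hcw (c i + 1) (by have := hc.lt i; omega)
    refine absurd h1 (not_le.2 (cnt_lt (fun p hp hpc => ?_) (q := i) (by omega) (by omega)
      (by omega)))
    have mp := hAw.mono p
    rcases lt_trichotomy p i with h | h | h
    · have := hcond p i h (by omega)
      omega
    · subst h
      omega
    · by_cases hpk : p = ⟨k, hk⟩
      · subst hpk
        omega
      · have hp' : p.1 < k := by
          have : p.1 ≠ k := fun e => hpk (Fin.ext e)
          omega
        have h2 := hch.2.2 p h hp'
        have h3 := hcross p hp
        omega
  have hfix : ∀ p : Fin n, k ≤ p.1 → c p = val w p := by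
    intro p hp
    rcases hp.lt_or_eq with h | h
    · rw [hA.fix p h, hAw.fix p h]
    · have : p = ⟨k, hk⟩ := Fin.ext h.symm
      rw [this, hwk]
  refine ⟨hfix, hmono, fun p => (hAw.side p).symm.trans (hA.side p), fun y => ?_, ?_⟩
  · have h1 := (hAw.inAbs y).symm.trans (hA.inAbs y)
    rw [inAbs_succ hk, inAbs_succ hk, hwk] at h1
    have h2 := IsCol.not_inAbs hk (isCol_val (k + 1) w) (y := y)
    have h3 := IsCol.not_inAbs hk hc (y := y)
    rw [hwk] at h2
    tauto
  · intro y hy hn p hp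
    have hpk : p.1 < k := by
      by_contra h
      have := hfix p (by omega)
      omega
    have mp := hAw.mono p
    -- The newly inactive letters are `c(k)` and its bar, excluded by the condition and by `hcross`.
    -- All others were already inactive.
    by_cases hn' : InAbs (k + 1) (val w) y
    · rcases (inAbs_succ hk _ _).1 hn' with h | h
      · exact hn h
      · have h1 := hcross p (by omega)
        have h2 := hcond p ⟨k, hk⟩ hpk (by simp)
        have h3 : c p ≠ c ⟨k, hk⟩ := fun e => by
          have := hc.inj p _ (by omega) (by simp) e
          rw [this] at hpk
          simp at hpk
        omega
    · rw [← hAw.inAbs y] at hn'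
      have := hA.not_cross y hy hn' p
      omega

theorem exists_reach {n k : ℕ} (hk : k ≤ n) {u : SignedPerm n} {c : Fin n → ℕ}
    (hc : IsCol k c) (hA : Ascent k (val u) c)
    (hcond : ∀ i l : Fin n, i < l → l.1 < k → ¬ (val u i ≤ c l ∧ c l < c i)) :
    ∃ v, Reach (revGamma n k) u v ∧ ∀ p, val v p = c p := by
  induction k generalizing u with
  | zero => exact ⟨u, .nil u, fun p => (hA.fix p (Nat.zero_le _)).symm⟩
  | succ k ih =>
    obtain ⟨w, hw, hwk⟩ := exists_segment_to hk hc hA hcond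
    have hAw := hw.ascent (m := k + 1) fun α hα => isPlusBelow_of_mem_segment hα (by simp)
    obtain ⟨v, hv, hv'⟩ := ih (by omega) (hc.mono (by omega))
      (hA.after_segment hk hc hcond hw hwk) fun i l hil hl h =>
        hcond i l hil (by omega) ⟨(hAw.mono i).trans h.1, h.2⟩
    exact ⟨v, by rw [revGamma_succ hk]; exact reach_append_iff.2 ⟨w, hw, hv⟩, hv'⟩

/-! ### Columns of letters, sorting and thresholds -/

theorem bar_lt_bar {n : ℕ} {x y : Letter n} : bar x < bar y ↔ y < x := Fin.rev_lt_rev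

theorem bar_le_bar {n : ℕ} {x y : Letter n} : bar x ≤ bar y ↔ y ≤ x := Fin.rev_le_rev

theorem isUnbarred_bar {n : ℕ} (x : Letter n) : IsUnbarred (bar x) ↔ ¬ IsUnbarred x := by
  have := bar_val x
  simp only [IsUnbarred]
  omega

theorem bar_ne_self {n : ℕ} (x : Letter n) : bar x ≠ x := by
  intro h
  have := isUnbarred_bar x
  rw [h] at this
  tauto

theorem absLetter_bar {n : ℕ} (x : Letter n) : absLetter (bar x) = absLetter x := by
  rw [absLetter, bar_bar, min_comm, absLetter]

theorem absLetter_eq_iff {n : ℕ} {x y : Letter n} :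
    absLetter x = absLetter y ↔ x = y ∨ x = bar y := by
  constructor
  · intro h
    have hx := bar_val x
    have hy := bar_val y
    simp only [absLetter, Fin.ext_iff] at h ⊢
    rcases le_total x (bar x) with h1 | h1 <;> rcases le_total y (bar y) with h2 | h2 <;>
      simp only [min_eq_left, min_eq_right, h1, h2] at h <;> omega
  · rintro (rfl | rfl)
    · rfl
    · exact absLetter_bar y

theorem IsColumn.injective {n k : ℕ} {C : Fin k → Letter n} (h : IsColumn C) :
    Function.Injective C := fun _ _ e => h (congrArg absLetter e)

theorem IsColumn.ne_bar {n k : ℕ} {C : Fin k → Letter n} (h : IsColumn C) (i j : Fin k) :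
    C i ≠ bar (C j) := by
  intro e
  have hij : i = j := h (by simp only; rw [e, absLetter_bar])
  subst hij
  exact bar_ne_self _ e.symm

theorem IsColumn.not_mem_bar {n k : ℕ} {C : Fin k → Letter n} (h : IsColumn C) {y : Letter n}
    (h1 : y ∈ Set.range C) : bar y ∉ Set.range C := by
  rintro ⟨j, hj⟩
  obtain ⟨i, rfl⟩ := h1
  exact h.ne_bar j i hj

theorem ord_eq_ord_iff {n k : ℕ} {A B : Fin k → Letter n} :
    ord A = ord B ↔ ∃ σ : Equiv.Perm (Fin k), A = B ∘ σ := by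
  constructor
  · intro h
    refine ⟨(Tuple.sort A).symm.trans (Tuple.sort B), ?_⟩
    funext i
    have := congrFun h ((Tuple.sort A).symm i)
    simpa [ord] using this
  · rintro ⟨σ, rfl⟩
    have h1 : Monotone (B ∘ (σ * Tuple.sort (B ∘ σ) : Equiv.Perm (Fin k))) :=
      Tuple.monotone_sort (B ∘ σ)
    exact Tuple.unique_monotone h1 (Tuple.monotone_sort B)

/-- The letter `y` or its bar occurs in `C`. -/
def MemAbs {n k : ℕ} (C : Fin k → Letter n) (y : Letter n) : Prop :=
  y ∈ Set.range C ∨ bar y ∈ Set.range C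

theorem memAbs_bar {n k : ℕ} {C : Fin k → Letter n} {y : Letter n} :
    MemAbs C (bar y) ↔ MemAbs C y := by
  unfold MemAbs
  rw [bar_bar, or_comm]

theorem memAbs_comp {n k : ℕ} (C : Fin k → Letter n) (σ : Equiv.Perm (Fin k)) (y : Letter n) :
    MemAbs (C ∘ σ) y ↔ MemAbs C y := by
  unfold MemAbs
  rw [EquivLike.range_comp]

/-- The number of entries of `C` that are at least `y`. -/
def countGE {n k : ℕ} (C : Fin k → Letter n) (y : ℕ) : ℕ :=
  (Finset.univ.filter fun i => y ≤ (C i).1).card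

theorem countGE_comp {n k : ℕ} (C : Fin k → Letter n) (σ : Equiv.Perm (Fin k)) (y : ℕ) :
    countGE (C ∘ σ) y = countGE C y := by
  refine Finset.card_bij (fun i _ => σ i) ?_ (fun _ _ _ _ h => σ.injective h) ?_
  · intro i hi
    simpa using hi
  · intro i hi
    exact ⟨σ.symm i, by simpa using hi, by simp⟩

/-- The numerical form of the condition that two columns split a Kashiwara–Nakashima column. -/
structure Compatible {n k : ℕ} (C C' : Fin k → Letter n) : Prop where
  abs : ∀ y, MemAbs C y ↔ MemAbs C' y
  le : ∀ y, countGE C y ≤ countGE C' y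
  eq : ∀ y : Letter n, ¬ MemAbs C y → countGE C y.1 = countGE C' y.1
  mid : countGE C n = countGE C' n

theorem compatible_comp_iff {n k : ℕ} (C C' : Fin k → Letter n) (σ τ : Equiv.Perm (Fin k)) :
    Compatible (C ∘ σ) (C' ∘ τ) ↔ Compatible C C' := by
  constructor
  · rintro ⟨h1, h2, h3, h4⟩
    simp only [memAbs_comp, countGE_comp] at h1 h2 h3 h4
    exact ⟨h1, h2, h3, h4⟩
  · rintro ⟨h1, h2, h3, h4⟩
    constructor <;> simp only [memAbs_comp, countGE_comp] <;> assumption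

/-! ### From a KN column to the counting condition -/

section Replace

variable {n k r : ℕ} {z t : Fin r → Letter n}

theorem extend_id_cases (hz : Function.Injective z) (x : Letter n) :
    (∃ i, x = z i ∧ Function.extend z t id x = t i) ∨
      ((∀ i, x ≠ z i) ∧ Function.extend z t id x = x) := by
  by_cases h : ∃ i, z i = x
  · obtain ⟨i, rfl⟩ := h
    exact Or.inl ⟨i, rfl, hz.extend_apply t id i⟩
  · exact Or.inr ⟨fun i e => h ⟨i, e.symm⟩, Function.extend_apply' t id x h⟩

/-- Replacing `z_i` loses no absolute value, since the bar of `z_i` stays in the column. -/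
theorem memAbs_replace_iff (hz : Function.Injective z) {D : Fin k → Letter n}
    (h1 : ∀ i, z i ∈ Set.range D) (h2 : ∀ i, bar (z i) ∈ Set.range D)
    (h3 : ∀ i j, bar (z i) ≠ z j) (y : Letter n) :
    MemAbs (Function.extend z t id ∘ D) y ↔ MemAbs D y ∨ ∃ j, y = t j ∨ bar y = t j := by
  have key : ∀ x ∈ Set.range D, MemAbs (Function.extend z t id ∘ D) x := by
    rintro x ⟨p, rfl⟩
    rcases extend_id_cases (t := t) hz (D p) with ⟨i, hi, -⟩ | ⟨-, hp⟩
    · obtain ⟨q, hq⟩ := h2 i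
      right
      refine ⟨q, ?_⟩
      rcases extend_id_cases (t := t) hz (D q) with ⟨j, hj, -⟩ | ⟨-, hp⟩
      · exact absurd (hq.symm.trans hj) (h3 i j)
      · rw [Function.comp_apply, hp, hq, hi]
    · exact Or.inl ⟨p, hp⟩
  have key' : ∀ x ∈ Set.range (Function.extend z t id ∘ D), x ∈ Set.range D ∨ ∃ j, x = t j := by
    rintro x ⟨p, rfl⟩
    rcases extend_id_cases (t := t) hz (D p) with ⟨i, hi, hp⟩ | ⟨-, hp⟩
    · exact Or.inr ⟨i, hp⟩
    · exact Or.inl ⟨p, hp.symm⟩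
  have keyt : ∀ j, t j ∈ Set.range (Function.extend z t id ∘ D) := by
    intro j
    obtain ⟨p, hp⟩ := h1 j
    exact ⟨p, by rw [Function.comp_apply, hp, hz.extend_apply]⟩
  constructor
  · rintro (h | h)
    · rcases key' y h with h | ⟨j, h⟩
      · exact Or.inl (Or.inl h)
      · exact Or.inr ⟨j, Or.inl h⟩
    · rcases key' _ h with h | ⟨j, h⟩
      · exact Or.inl (Or.inr h)
      · exact Or.inr ⟨j, Or.inr h⟩
  · rintro ((h | h) | ⟨j, h | h⟩)
    · exact key y h
    · exact memAbs_bar.1 (key _ h)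
    · exact Or.inl (h ▸ keyt j)
    · exact Or.inr (h ▸ keyt j)

end Replace

section PairSeq

variable {n k : ℕ} (D : Fin k → Letter n)

theorem pairSeq_strictAnti : StrictAnti (pairSeq D) := fun _ _ h =>
  (Finset.orderEmbOfFin _ rfl).strictMono (Fin.rev_lt_rev.2 h)

theorem mem_pairSet {x : Letter n} :
    x ∈ pairSet D ↔ IsUnbarred x ∧ x ∈ Set.range D ∧ bar x ∈ Set.range D := by
  classical
  simp only [pairSet, Finset.mem_filter, Finset.mem_univ, true_and]

theorem pairSeq_mem (i : Fin (pairSet D).card) :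
    IsUnbarred (pairSeq D i) ∧ pairSeq D i ∈ Set.range D ∧ bar (pairSeq D i) ∈ Set.range D :=
  (mem_pairSet D).1 (Finset.orderEmbOfFin_mem _ _ _)

end PairSeq

/-- An absent letter between `t_i` and `z_i` contradicts the maximality of `t_i` unless it is `≥
t_{i-1}`. In that case it equals `t_{i-1}` or lies between `t_{i-1}` and `z_{i-1}`, and induction
applies. -/
theorem IsSplitting.mem_of_between {n k : ℕ} {D : Fin k → Letter n}
    {t : Fin (pairSet D).card → Letter n} (ht : IsSplitting D t) (i : Fin (pairSet D).card)
    {x : Letter n} (h1 : t i < x) (h2 : x < pairSeq D i) : MemAbs D x ∨ ∃ j, x = t j := by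
  obtain ⟨m, hm⟩ := i
  induction m with
  | zero =>
    by_contra hn
    rw [not_or, MemAbs, not_or] at hn
    have hu : IsUnbarred x := lt_trans (Fin.lt_def.1 h2) (pairSeq_mem D _).1
    exact absurd ((ht ⟨0, hm⟩).2 ⟨hu, h2, fun j hj => absurd hj (by simp), hn.1.1, hn.1.2⟩)
      (not_le.2 h1)
  | succ m ih =>
    by_contra hn
    have hn' := hn
    rw [not_or, MemAbs, not_or] at hn
    have hu : IsUnbarred x := lt_trans (Fin.lt_def.1 h2) (pairSeq_mem D _).1
    refine absurd ((ht ⟨m + 1, hm⟩).2 ⟨hu, h2, fun j hj => ?_, hn.1.1, hn.1.2⟩) (not_le.2 h1)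
    have hjm : j = ⟨m, Nat.lt_of_succ_lt hm⟩ := Fin.ext (by simpa using hj)
    subst hjm
    by_contra hlt
    rcases (not_lt.1 hlt).lt_or_eq with h | h
    · exact hn' (ih (by omega) h (h2.trans (pairSeq_strictAnti D (by simp [Fin.lt_def]))))
    · exact hn.2 ⟨_, h.symm⟩

/-- Position by position, the two fillings differ by `t_i ↦ z_i` and `z̄_i ↦ t̄_i`, both upward and
within one side. By `IsSplitting.mem_of_between`, these moves cross no letter of absent absolute
value. -/
theorem KNColumn.compatible {n k : ℕ} (D : KNColumn n k) :
    Compatible (Function.extend (pairSeq D.entries) D.t id ∘ D.entries)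
      (Function.extend (bar ∘ pairSeq D.entries) (bar ∘ D.t) id ∘ D.entries) := by
  obtain ⟨E, -, t, ht⟩ := D
  simp only
  set z := pairSeq E with hz
  have hz1 : Function.Injective z := (pairSeq_strictAnti E).injective
  have hz2 : Function.Injective (bar ∘ z) := bar_injective.comp hz1
  have hzm := pairSeq_mem E
  have hbz : ∀ i j, bar (z i) ≠ z j := by
    intro i j e
    have h1 := (hzm j).1
    rw [← hz, ← e, isUnbarred_bar] at h1
    exact h1 (hzm i).1
  have htz : ∀ i, t i < z i := fun i => (ht i).1.2.1
  have hL := memAbs_replace_iff (t := t) hz1 (D := E) (fun i => (hzm i).2.1)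
    (fun i => (hzm i).2.2) hbz
  have hR := memAbs_replace_iff (t := bar ∘ t) hz2 (D := E) (fun i => (hzm i).2.2)
    (fun i => by rw [Function.comp_apply, bar_bar]; exact (hzm i).2.1)
    (fun i j e => by
      simp only [Function.comp_apply, bar_bar] at e
      exact hbz j i e.symm)
  have hcases : ∀ p, (∃ i, E p = z i ∧ Function.extend z t id (E p) = t i ∧
        Function.extend (bar ∘ z) (bar ∘ t) id (E p) = z i) ∨
      (∃ i, E p = bar (z i) ∧ Function.extend z t id (E p) = bar (z i) ∧
        Function.extend (bar ∘ z) (bar ∘ t) id (E p) = bar (t i)) ∨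
      (Function.extend z t id (E p) = E p ∧
        Function.extend (bar ∘ z) (bar ∘ t) id (E p) = E p) := by
    intro p
    rcases extend_id_cases (t := t) hz1 (E p) with ⟨i, h1, h2⟩ | ⟨h1, h2⟩ <;>
      rcases extend_id_cases (t := bar ∘ t) hz2 (E p) with ⟨j, h3, h4⟩ | ⟨h3, h4⟩
    · exact absurd (h3.symm.trans h1) (hbz j i)
    · exact Or.inl ⟨i, h1, h2, h4.trans h1⟩
    · exact Or.inr (Or.inl ⟨j, h3, h2.trans h3, h4⟩)
    · exact Or.inr (Or.inr ⟨h2, h4⟩)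
  have hcnt : ∀ y : ℕ, (∀ i, ¬ ((t i).1 < y ∧ y ≤ (z i).1)) →
      (∀ i, ¬ ((bar (z i)).1 < y ∧ y ≤ (bar (t i)).1)) →
      countGE (Function.extend z t id ∘ E) y =
        countGE (Function.extend (bar ∘ z) (bar ∘ t) id ∘ E) y := by
    intro y h1 h2
    unfold countGE
    congr 1
    refine Finset.filter_congr fun p _ => ?_
    simp only [Function.comp_apply]
    rcases hcases p with ⟨i, -, h3, h4⟩ | ⟨i, -, h3, h4⟩ | ⟨h3, h4⟩ <;> rw [h3, h4]
    · have := h1 i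
      have := Fin.lt_def.1 (htz i)
      omega
    · have := h2 i
      have := Fin.lt_def.1 (bar_lt_bar.2 (htz i))
      omega
  refine ⟨fun y => ?_, fun y => ?_, fun y hy => ?_, ?_⟩
  · rw [hL, hR]
    refine or_congr_right (exists_congr fun j => ?_)
    simp only [Function.comp_apply]
    rw [bar_injective.eq_iff, ← bar_injective.eq_iff (b := bar (t j)), bar_bar, or_comm]
  · refine Finset.card_le_card fun p => ?_
    simp only [Finset.mem_filter, Finset.mem_univ, true_and, Function.comp_apply]
    rcases hcases p with ⟨i, -, h3, h4⟩ | ⟨i, -, h3, h4⟩ | ⟨h3, h4⟩ <;> rw [h3, h4]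
    · have := Fin.lt_def.1 (htz i)
      omega
    · have := Fin.lt_def.1 (bar_lt_bar.2 (htz i))
      omega
    · exact id
  · rw [hL, not_or, not_exists] at hy
    have hgap : ∀ i x, (x = y ∨ x = bar y) → t i ≤ x → x ≤ z i → False := by
      intro i x hx h1 h2
      have hx1 : ¬ MemAbs E x := by
        rcases hx with rfl | rfl
        · exact hy.1
        · rw [memAbs_bar]
          exact hy.1
      have hx2 : ∀ j, x ≠ t j := fun j e => hy.2 j (by
        rcases hx with rfl | rfl
        · exact Or.inl e
        · exact Or.inr e)
      rcases h2.lt_or_eq with h2 | rfl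
      · rcases ht.mem_of_between i (lt_of_le_of_ne h1 (hx2 i).symm) h2 with h | ⟨j, h⟩
        · exact hx1 h
        · exact hx2 j h
      · exact hx1 (Or.inl (hzm i).2.1)
    refine hcnt y.1 (fun i h => hgap i y (Or.inl rfl) (Fin.le_def.2 h.1.le) (Fin.le_def.2 h.2))
      (fun i h => hgap i (bar y) (Or.inr rfl) ?_ ?_)
    · rw [← bar_le_bar, bar_bar]
      exact Fin.le_def.2 h.2
    · rw [← bar_le_bar, bar_bar]
      exact Fin.le_def.2 h.1.le
  · refine hcnt n (fun i h => ?_) (fun i h => ?_)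
    · exact absurd (hzm i).1 (not_lt.2 h.2)
    · have h1 := (ht i).1.1
      have h2 := (isUnbarred_bar (z i)).1 h.1
      exact h2 (hzm i).1

theorem compatible_of_ord_eq {n k : ℕ} {C C' : Fin k → Letter n} (D : KNColumn n k)
    (hR : ord C' = D.right) (hL : ord C = D.left) : Compatible C C' := by
  obtain ⟨σ, rfl⟩ := ord_eq_ord_iff.1 hR
  obtain ⟨τ, rfl⟩ := ord_eq_ord_iff.1 hL
  exact (compatible_comp_iff _ _ _ _).2 D.compatible

theorem exists_perm_of_forall_mem_range {n k : ℕ} {A B : Fin k → Letter n}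
    (hA : Function.Injective A) (h : ∀ i, A i ∈ Set.range B) :
    ∃ σ : Equiv.Perm (Fin k), A = B ∘ σ := by
  choose σ hσ using h
  have hinj : Function.Injective σ := fun i j e => hA (by rw [← hσ i, ← hσ j, e])
  exact ⟨Equiv.ofBijective σ (Finite.injective_iff_bijective.1 hinj), funext fun i => (hσ i).symm⟩

/-! ### From the counting condition to a KN column -/

section RevEnum

variable {α : Type*} [LinearOrder α] {s : Finset α} {r : ℕ} (hs : s.card = r)

theorem card_filter_le_eq_card_rev (x : α) : (s.filter fun y => x ≤ y).card =
    (Finset.univ.filter fun j : Fin r => x ≤ s.orderEmbOfFin hs (Fin.rev j)).card := by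
  symm
  refine Finset.card_bij (fun j _ => s.orderEmbOfFin hs (Fin.rev j)) ?_ ?_ ?_
  · intro j hj
    simp only [Finset.mem_filter, Finset.mem_univ, true_and] at hj ⊢
    exact ⟨Finset.orderEmbOfFin_mem _ _ _, hj⟩
  · intro i _ j _ h
    exact Fin.rev_injective ((s.orderEmbOfFin hs).injective h)
  · intro y hy
    simp only [Finset.mem_filter] at hy
    have : y ∈ Set.range (s.orderEmbOfFin hs) := by
      rw [Finset.range_orderEmbOfFin]
      exact hy.1
    obtain ⟨i, rfl⟩ := this
    exact ⟨Fin.rev i, by simpa using hy.2, by simp⟩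

theorem succ_le_card_filter_of_le {x : α} {i : Fin r}
    (h : x ≤ s.orderEmbOfFin hs (Fin.rev i)) : i.1 + 1 ≤ (s.filter fun y => x ≤ y).card := by
  rw [card_filter_le_eq_card_rev hs, ← Fin.card_Iic]
  refine Finset.card_le_card fun j hj => ?_
  simp only [Finset.mem_filter, Finset.mem_univ, true_and, Finset.mem_Iic] at hj ⊢
  exact h.trans ((s.orderEmbOfFin hs).monotone (Fin.rev_le_rev.2 hj))

theorem card_filter_le_of_lt {x : α} {i : Fin r}
    (h : s.orderEmbOfFin hs (Fin.rev i) < x) : (s.filter fun y => x ≤ y).card ≤ i.1 := by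
  rw [card_filter_le_eq_card_rev hs, ← Fin.card_Iio]
  refine Finset.card_le_card fun j hj => ?_
  simp only [Finset.mem_filter, Finset.mem_univ, true_and, Finset.mem_Iio] at hj ⊢
  by_contra hij
  exact absurd (hj.trans ((s.orderEmbOfFin hs).monotone (Fin.rev_le_rev.2 (not_lt.1 hij))))
    (not_le.2 h)

end RevEnum

section Converse

variable {n k : ℕ} {C C' : Fin k → Letter n}

open Classical in
theorem countGE_eq_add (hC : Function.Injective C) {y : ℕ} (hy : y ≤ n) :
    countGE C y = (Finset.univ.filter fun s : Letter n =>
      s ∈ Set.range C ∧ IsUnbarred s ∧ y ≤ s.1).card + countGE C n := by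
  have h1 : (Finset.univ.filter fun s : Letter n =>
      s ∈ Set.range C ∧ IsUnbarred s ∧ y ≤ s.1) =
      (Finset.univ.filter fun i => IsUnbarred (C i) ∧ y ≤ (C i).1).image C := by
    ext s
    simp only [Finset.mem_filter, Finset.mem_univ, true_and, Finset.mem_image]
    constructor
    · rintro ⟨⟨i, rfl⟩, h⟩
      exact ⟨i, h, rfl⟩
    · rintro ⟨i, h, rfl⟩
      exact ⟨⟨i, rfl⟩, h⟩
  rw [h1, Finset.card_image_of_injective _ hC, countGE, countGE,
    ← Finset.card_union_of_disjoint]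
  · congr 1
    ext i
    simp only [Finset.mem_filter, Finset.mem_univ, true_and, Finset.mem_union]
    simp only [IsUnbarred]
    omega
  · rw [Finset.disjoint_left]
    intro i
    simp only [Finset.mem_filter, Finset.mem_univ, true_and]
    simp only [IsUnbarred]
    omega

open Classical in
/-- The unbarred letters of `C` whose bars occur in `C'`. -/
noncomputable def flipSet (C C' : Fin k → Letter n) : Finset (Letter n) :=
  Finset.univ.filter fun s => IsUnbarred s ∧ s ∈ Set.range C ∧ bar s ∈ Set.range C'

theorem mem_flipSet {s : Letter n} :
    s ∈ flipSet C C' ↔ IsUnbarred s ∧ s ∈ Set.range C ∧ bar s ∈ Set.range C' := by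
  classical
  simp only [flipSet, Finset.mem_filter, Finset.mem_univ, true_and]

/-- An absolute value unbarred in both columns cancels in the difference of the counts. The
remaining unbarred letters form the two flip sets, and the barred parts cancel by `mid`. -/
theorem Compatible.flipSet_card (h : Compatible C C') (hC : IsColumn C) (hC' : IsColumn C')
    {y : ℕ} (hy : y ≤ n) :
    ((flipSet C' C).filter fun s => y ≤ s.1).card + countGE C y =
      ((flipSet C C').filter fun s => y ≤ s.1).card + countGE C' y := by
  classical
  rw [countGE_eq_add hC.injective hy, countGE_eq_add hC'.injective hy, h.mid]
  have key : ∀ A B : Fin k → Letter n, IsColumn A → IsColumn B →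
      (∀ y, MemAbs A y ↔ MemAbs B y) → (flipSet A B).filter (fun s => y ≤ s.1) =
        (Finset.univ.filter fun s : Letter n => s ∈ Set.range A ∧ IsUnbarred s ∧ y ≤ s.1) \
        (Finset.univ.filter fun s : Letter n => s ∈ Set.range B ∧ IsUnbarred s ∧ y ≤ s.1) := by
    intro A B hA hB hAB
    ext s
    simp only [Finset.mem_filter, mem_flipSet, Finset.mem_sdiff, Finset.mem_univ, true_and]
    have h1 := (hAB s).1
    have h2 := fun h => hB.not_mem_bar (y := s) h
    unfold MemAbs at h1
    tauto
  rw [key C' C hC' hC fun y => (h.abs y).symm, key C C' hC hC' h.abs]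
  have h1 := Finset.card_sdiff_add_card
    (Finset.univ.filter fun s : Letter n => s ∈ Set.range C' ∧ IsUnbarred s ∧ y ≤ s.1)
    (Finset.univ.filter fun s : Letter n => s ∈ Set.range C ∧ IsUnbarred s ∧ y ≤ s.1)
  have h2 := Finset.card_sdiff_add_card
    (Finset.univ.filter fun s : Letter n => s ∈ Set.range C ∧ IsUnbarred s ∧ y ≤ s.1)
    (Finset.univ.filter fun s : Letter n => s ∈ Set.range C' ∧ IsUnbarred s ∧ y ≤ s.1)
  rw [Finset.union_comm] at h2
  omega

open Classical in
/-- The unbarred letters of `C'` and the barred letters of `C`. -/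
noncomputable def mergeSet (C C' : Fin k → Letter n) : Finset (Letter n) :=
  Finset.univ.filter fun s =>
    (IsUnbarred s ∧ s ∈ Set.range C') ∨ (¬ IsUnbarred s ∧ s ∈ Set.range C)

theorem mem_mergeSet {s : Letter n} : s ∈ mergeSet C C' ↔
    (IsUnbarred s ∧ s ∈ Set.range C') ∨ (¬ IsUnbarred s ∧ s ∈ Set.range C) := by
  classical
  simp only [mergeSet, Finset.mem_filter, Finset.mem_univ, true_and]

theorem card_mergeSet (hC : Function.Injective C) (hC' : Function.Injective C')
    (h : countGE C n = countGE C' n) : (mergeSet C C').card = k := by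
  classical
  have h1 : mergeSet C C' = (Finset.univ.filter fun i => ¬ n ≤ (C' i).1).image C' ∪
      (Finset.univ.filter fun i => n ≤ (C i).1).image C := by
    ext s
    simp only [mem_mergeSet, Finset.mem_union, Finset.mem_image, Finset.mem_filter,
      Finset.mem_univ, true_and, IsUnbarred, not_lt, not_le]
    constructor
    · rintro (⟨h1, i, rfl⟩ | ⟨h1, i, rfl⟩)
      · exact Or.inl ⟨i, h1, rfl⟩
      · exact Or.inr ⟨i, h1, rfl⟩
    · rintro (⟨i, h1, rfl⟩ | ⟨i, h1, rfl⟩)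
      · exact Or.inl ⟨h1, i, rfl⟩
      · exact Or.inr ⟨h1, i, rfl⟩
  have h2 : (Finset.univ.filter fun i => n ≤ (C' i).1).card +
      (Finset.univ.filter fun i => ¬ n ≤ (C' i).1).card = k := by
    rw [Finset.card_filter_add_card_filter_not, Finset.card_univ, Fintype.card_fin]
  rw [h1, Finset.card_union_of_disjoint, Finset.card_image_of_injective _ hC',
    Finset.card_image_of_injective _ hC]
  · unfold countGE at h
    omega
  · rw [Finset.disjoint_left]
    simp only [Finset.mem_image, Finset.mem_filter, Finset.mem_univ, true_and]
    rintro s ⟨i, h1, rfl⟩ ⟨j, h2, h3⟩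
    rw [h3] at h2
    exact h1 h2

/-- `D` must consist of the unbarred letters of `C'` and the barred letters of `C`, since `rD` keeps
the former and `lD` the latter. Its pairs `z` are then the letters unbarred in `C'` and barred in
`C`, and the `t` those unbarred in `C` and barred in `C'`. The count inequality gives `t_i < z_i`,
and equality at absent letters gives the maximality of `t_i`. -/
theorem Compatible.exists_knColumn (h : Compatible C C') (hC : IsColumn C) (hC' : IsColumn C') :
    ∃ D : KNColumn n k, ord C' = D.right ∧ ord C = D.left := by
  have hcard := card_mergeSet hC.injective hC'.injective h.mid
  set D : Fin k → Letter n := ⇑((mergeSet C C').orderEmbOfFin hcard) with hD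
  have hDm : ∀ s, s ∈ Set.range D ↔
      (IsUnbarred s ∧ s ∈ Set.range C') ∨ (¬ IsUnbarred s ∧ s ∈ Set.range C) := by
    intro s
    rw [hD, Finset.range_orderEmbOfFin, Finset.mem_coe, mem_mergeSet]
  have hDu : ∀ s, IsUnbarred s → (s ∈ Set.range D ↔ s ∈ Set.range C') := by
    intro s hs
    rw [hDm]
    tauto
  have hDb : ∀ s, IsUnbarred s → (bar s ∈ Set.range D ↔ bar s ∈ Set.range C) := by
    intro s hs
    rw [hDm, isUnbarred_bar]
    tauto
  have hI : pairSet D = flipSet C' C := by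
    ext s
    rw [mem_pairSet, mem_flipSet]
    have h1 := hDu s
    have h2 := hDb s
    tauto
  have hTI : (flipSet C C').card = (pairSet D).card := by
    have h1 := h.flipSet_card hC hC' (Nat.zero_le n)
    simp only [Nat.zero_le, Finset.filter_true] at h1
    have h2 : countGE C 0 = countGE C' 0 := by simp [countGE]
    rw [hI]
    omega
  set z := pairSeq D with hz
  set t : Fin (pairSet D).card → Letter n :=
    fun i => (flipSet C C').orderEmbOfFin hTI (Fin.rev i) with ht
  have htm : ∀ i, IsUnbarred (t i) ∧ t i ∈ Set.range C ∧ bar (t i) ∈ Set.range C' :=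
    fun i => mem_flipSet.1 (Finset.orderEmbOfFin_mem _ _ _)
  have htex : ∀ s ∈ flipSet C C', ∃ i, t i = s := by
    intro s hs
    have : s ∈ Set.range ((flipSet C C').orderEmbOfFin hTI) := by
      rw [Finset.range_orderEmbOfFin]
      exact hs
    obtain ⟨i, hi⟩ := this
    exact ⟨Fin.rev i, by simp only [ht, Fin.rev_rev, hi]⟩
  have hta : StrictAnti t := fun i j hij =>
    ((flipSet C C').orderEmbOfFin hTI).strictMono (Fin.rev_lt_rev.2 hij)
  have hza := pairSeq_strictAnti D
  have hzm : ∀ i, IsUnbarred (z i) ∧ z i ∈ Set.range C' ∧ bar (z i) ∈ Set.range C := fun i => by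
    have h1 := pairSeq_mem D i
    exact ⟨h1.1, (hDu _ h1.1).1 h1.2.1, (hDb _ h1.1).1 h1.2.2⟩
  have hcnt : ∀ x : Letter n, IsUnbarred x →
      ((pairSet D).filter fun s => x ≤ s).card + countGE C x.1 =
      ((flipSet C C').filter fun s => x ≤ s).card + countGE C' x.1 := by
    intro x hx
    rw [hI]
    exact h.flipSet_card hC hC' hx.le
  have hsplit : IsSplitting D t := by
    intro i
    refine ⟨⟨(htm i).1, ?_, fun j hj => hta (by simp only [Fin.lt_def]; omega), ?_, ?_⟩, ?_⟩
    · by_contra hlt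
      -- If `z_i < t_i`, then at the threshold `t_i` there are at least `i + 1` letters `t` and at
      -- most `i` letters `z` (indices from zero), against `h.le`.
      rcases (not_lt.1 hlt).lt_or_eq with h1 | h1
      · have h2 := card_filter_le_of_lt rfl h1
        have h3 := succ_le_card_filter_of_le hTI (le_refl (t i))
        have h4 := hcnt (t i) (htm i).1
        have h5 := h.le (t i).1
        omega
      · have h2 : bar (t i) ∈ Set.range C := h1 ▸ (hzm i).2.2
        exact hC.not_mem_bar (htm i).2.1 h2
    · rw [hDu _ (htm i).1]
      exact fun h1 => hC'.not_mem_bar h1 (htm i).2.2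
    · rw [hDb _ (htm i).1]
      exact hC.not_mem_bar (htm i).2.1
    · rintro x ⟨hx1, hx2, hx3, hx4, hx5⟩
      by_contra hlt
      rw [not_le] at hlt
      rw [hDu x hx1] at hx4
      rw [hDb x hx1] at hx5
      -- A candidate `x > t_i` of present absolute value is some `t_j` with `j < i`, so it is not
      -- below `t_{i-1}`. One of absent absolute value has as many `z` as `t` above it, but at least
      -- `i + 1` of the former and at most `i` of the latter.
      by_cases hx : MemAbs C x
      · have hxC : x ∈ Set.range C := hx.resolve_right hx5
        have hxC' : bar x ∈ Set.range C' := ((h.abs x).1 hx).resolve_left hx4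
        obtain ⟨j, rfl⟩ := htex x (mem_flipSet.2 ⟨hx1, hxC, hxC'⟩)
        have hji : j < i := hta.lt_iff_gt.1 hlt
        have hi0 : i.1 - 1 < (pairSet D).card := by omega
        have h1 := hx3 ⟨i.1 - 1, hi0⟩ (by
          simp only
          have : j.1 < i.1 := hji
          omega)
        have h2 := hta.lt_iff_gt.1 h1
        simp only [Fin.lt_def] at h2 hji
        omega
      · have h1 := h.eq x hx
        have h2 := hcnt x hx1
        have h3 := card_filter_le_of_lt hTI hlt
        have h4 := succ_le_card_filter_of_le rfl hx2.le
        omega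
  refine ⟨⟨D, ((mergeSet C C').orderEmbOfFin hcard).strictMono, t, hsplit⟩,
    ord_eq_ord_iff.2 (exists_perm_of_forall_mem_range hC'.injective fun i => ?_),
    ord_eq_ord_iff.2 (exists_perm_of_forall_mem_range hC.injective fun i => ?_)⟩
  · have hzi : Function.Injective (bar ∘ z) := bar_injective.comp hza.injective
    simp only
    by_cases hu : IsUnbarred (C' i)
    · obtain ⟨p, hp⟩ := (hDu _ hu).2 ⟨i, rfl⟩
      refine ⟨p, ?_⟩
      rcases extend_id_cases (t := bar ∘ t) hzi (D p) with ⟨j, h1, -⟩ | ⟨-, h1⟩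
      · rw [hp] at h1
        rw [h1, Function.comp_apply, isUnbarred_bar] at hu
        exact absurd (hzm j).1 hu
      · exact h1.trans hp
    · have hu' : IsUnbarred (bar (C' i)) := (isUnbarred_bar _).2 hu
      by_cases hm : C' i ∈ Set.range C
      · obtain ⟨p, hp⟩ := (hDm (C' i)).2 (Or.inr ⟨hu, hm⟩)
        refine ⟨p, ?_⟩
        rcases extend_id_cases (t := bar ∘ t) hzi (D p) with ⟨j, h1, -⟩ | ⟨-, h1⟩
        · rw [hp, Function.comp_apply] at h1
          obtain ⟨q, hq⟩ := (hzm j).2.1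
          exact absurd (h1.trans (by rw [hq])) (hC'.ne_bar i q)
        · exact h1.trans hp
      · have hb : bar (C' i) ∈ Set.range C :=
          ((h.abs (C' i)).2 (Or.inl ⟨i, rfl⟩)).resolve_left hm
        obtain ⟨j, hj⟩ := htex _ (mem_flipSet.2 ⟨hu', hb, by rw [bar_bar]; exact ⟨i, rfl⟩⟩)
        obtain ⟨p, hp⟩ := (pairSeq_mem D j).2.2
        refine ⟨p, ?_⟩
        have h1 := hzi.extend_apply (bar ∘ t) id j
        simp only [Function.comp_apply] at h1 ⊢
        rw [hp, h1, hj, bar_bar]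
  · have hzi : Function.Injective z := hza.injective
    simp only
    by_cases hu : IsUnbarred (C i)
    · by_cases hm : C i ∈ Set.range C'
      · obtain ⟨p, hp⟩ := (hDu _ hu).2 hm
        refine ⟨p, ?_⟩
        rcases extend_id_cases (t := t) hzi (D p) with ⟨j, h1, -⟩ | ⟨-, h1⟩
        · rw [hp] at h1
          obtain ⟨q, hq⟩ := (hzm j).2.2
          exact absurd (by rw [h1, hq]) (hC.ne_bar q i)
        · exact h1.trans hp
      · have hb : bar (C i) ∈ Set.range C' :=
          ((h.abs (C i)).1 (Or.inl ⟨i, rfl⟩)).resolve_left hm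
        obtain ⟨j, hj⟩ := htex _ (mem_flipSet.2 ⟨hu, ⟨i, rfl⟩, hb⟩)
        obtain ⟨p, hp⟩ := (pairSeq_mem D j).2.1
        refine ⟨p, ?_⟩
        have h1 := hzi.extend_apply t id j
        simp only [Function.comp_apply]
        rw [hp, h1, hj]
    · obtain ⟨p, hp⟩ := (hDm (C i)).2 (Or.inr ⟨hu, ⟨i, rfl⟩⟩)
      refine ⟨p, ?_⟩
      rcases extend_id_cases (t := t) hzi (D p) with ⟨j, h1, -⟩ | ⟨-, h1⟩
      · rw [hp] at h1
        exact absurd (h1 ▸ (hzm j).1) hu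
      · exact h1.trans hp

end Converse

/-! ### Translation between columns and numerical functions -/

/-- Extension of a column of height `k` by the values of `u` at the remaining positions. -/
def extendColumn {n k : ℕ} (C' : Fin k → Letter n) (u : SignedPerm n) (p : Fin n) : ℕ :=
  if h : p.1 < k then (C' ⟨p.1, h⟩).1 else val u p

section Glue

variable {n k : ℕ} (hk : k ≤ n) {u : SignedPerm n} {C' : Fin k → Letter n}

theorem extendColumn_of_lt {p : Fin n} (h : p.1 < k) :
    extendColumn C' u p = (C' ⟨p.1, h⟩).1 := by
  simp [extendColumn, h]

theorem extendColumn_of_le {p : Fin n} (h : k ≤ p.1) : extendColumn C' u p = val u p := by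
  simp [extendColumn, not_lt.2 h]

theorem extendColumn_castLE (i : Fin k) :
    extendColumn C' u (Fin.castLE hk i) = (C' i).1 := extendColumn_of_lt (p := Fin.castLE hk i) i.2

theorem window_val (i : Fin k) : (window hk u i).1 = val u (Fin.castLE hk i) := rfl

theorem isColumn_window : IsColumn (window hk u) := by
  intro i j hij
  have h := absLetter_eq_iff.1 hij
  rcases h with h | h
  · have := val_injective u (congrArg Fin.val h)
    exact Fin.castLE_injective hk this
  · have h1 := congrArg Fin.val h
    have h2 := bar_val (window hk u j)
    have h3 := val_add_val_ne u (Fin.castLE hk i) (Fin.castLE hk j)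
    simp only [window_val] at h1 h2
    omega

theorem isCol_extendColumn (hC' : IsColumn C') : IsCol k (extendColumn C' u) := by
  refine ⟨fun p => ?_, fun p q hp hq h => ?_, fun p q hp hq h => ?_⟩
  · unfold extendColumn
    split_ifs with h
    · exact (C' _).2
    · exact val_lt u p
  · rw [extendColumn_of_lt hp, extendColumn_of_lt hq] at h
    have := hC'.injective (Fin.ext h)
    simpa [Fin.ext_iff] using this
  · rw [extendColumn_of_lt hp, extendColumn_of_lt hq] at h
    have h1 := bar_val (C' ⟨q.1, hq⟩)
    exact hC'.ne_bar ⟨p.1, hp⟩ ⟨q.1, hq⟩ (Fin.ext (by omega))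

theorem cnt_eq_countGE {C : Fin k → Letter n} {f : Fin n → ℕ}
    (h : ∀ i, f (Fin.castLE hk i) = (C i).1) (y : ℕ) : cnt k f y = countGE C y := by
  symm
  refine Finset.card_bij (fun i _ => Fin.castLE hk i) ?_
    (fun _ _ _ _ e => Fin.castLE_injective hk e) ?_
  · intro i hi
    simp only [Finset.mem_filter, Finset.mem_univ, true_and] at hi ⊢
    exact ⟨i.2, by rw [h]; exact hi⟩
  · intro p hp
    simp only [Finset.mem_filter, Finset.mem_univ, true_and] at hp
    have h1 := h ⟨p.1, hp.1⟩
    refine ⟨⟨p.1, hp.1⟩, ?_, rfl⟩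
    simp only [Finset.mem_filter, Finset.mem_univ, true_and]
    rw [← h1]
    exact hp.2

theorem inAbs_iff_memAbs {C : Fin k → Letter n} {f : Fin n → ℕ}
    (h : ∀ i, f (Fin.castLE hk i) = (C i).1) (y : Letter n) : InAbs k f y.1 ↔ MemAbs C y := by
  have hy := bar_val y
  constructor
  · rintro ⟨q, hq, h'⟩
    have h1 : f q = (C ⟨q.1, hq⟩).1 := h ⟨q.1, hq⟩
    rcases h' with h' | h'
    · exact Or.inl ⟨⟨q.1, hq⟩, Fin.ext (by omega)⟩
    · exact Or.inr ⟨⟨q.1, hq⟩, Fin.ext (by omega)⟩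
  · rintro (⟨i, hi⟩ | ⟨i, hi⟩)
    · exact ⟨Fin.castLE hk i, i.2, Or.inl (by rw [h, hi])⟩
    · exact ⟨Fin.castLE hk i, i.2, Or.inr (by rw [h, hi]; omega)⟩

theorem not_inAbs_of_ge {m : ℕ} {f : Fin n → ℕ} (hf : ∀ p, f p < 2 * n) {y : ℕ}
    (hy : 2 * n ≤ y) : ¬ InAbs m f y := by
  rintro ⟨q, -, h⟩
  have := hf q
  omega

theorem Ascent.compatible {c : Fin n → ℕ} (hA : Ascent k (val u) c)
    (hc : ∀ i, c (Fin.castLE hk i) = (C' i).1) : Compatible (window hk u) C' := by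
  have hu : ∀ i, val u (Fin.castLE hk i) = (window hk u i).1 := fun _ => rfl
  have hle : ∀ y, countGE (window hk u) y ≤ countGE C' y := fun y => by
    rw [← cnt_eq_countGE hk hu, ← cnt_eq_countGE hk hc]
    exact cnt_le fun p _ => by
      have := hA.mono p
      omega
  refine ⟨fun y => ?_, hle, fun y hy => ?_, ?_⟩
  · rw [← inAbs_iff_memAbs hk hu, ← inAbs_iff_memAbs hk hc]
    exact hA.inAbs _
  · refine (hle _).antisymm ?_
    rw [← cnt_eq_countGE hk hu, ← cnt_eq_countGE hk hc]
    rw [← inAbs_iff_memAbs hk hu] at hy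
    exact cnt_le fun p _ => hA.not_cross _ y.2 hy p
  · refine (hle _).antisymm ?_
    rw [← cnt_eq_countGE hk hu, ← cnt_eq_countGE hk hc]
    exact cnt_le fun p _ => by
      have := hA.side p
      omega

/-- When `C(i) ≤ C'(i)`, circular betweenness is linear betweenness: the other two cyclic orders
require `C'(i) < C(i)`. -/
theorem conditionOne_of_not_between
    (hmono : ∀ i, window hk u i ≤ C' i) (hC' : IsColumn C')
    (h : ∀ i l, i < l → ¬ (window hk u i ≤ C' l ∧ C' l < C' i)) :
    ConditionOne C' (window hk u) := by
  intro i l hil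
  have h1 := h i l hil
  have h2 := hmono i
  refine ⟨fun e => ?_, fun hs => ?_⟩
  · rw [e] at h1 h2
    exact h1 ⟨le_rfl, lt_of_le_of_ne h2 fun e' => hil.ne' (hC'.injective e')⟩
  · rw [Fin.sbtw_iff] at hs
    rcases hs with ⟨a, b⟩ | ⟨a, b⟩ | ⟨a, b⟩
    · exact h1 ⟨a.le, b⟩
    · exact absurd (h2.trans_lt b) (lt_irrefl _)
    · exact absurd (h2.trans_lt a) (lt_irrefl _)

/-- The circular condition and compatibility force the values to increase weakly. -/
theorem window_le_of_conditionOne (hcond : ConditionOne C' (window hk u))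
    (h : Compatible (window hk u) C') (i : Fin k) : window hk u i ≤ C' i := by
  have hu : ∀ i, val u (Fin.castLE hk i) = (window hk u i).1 := fun _ => rfl
  have hc : ∀ i, extendColumn C' u (Fin.castLE hk i) = (C' i).1 := extendColumn_castLE hk
  by_contra hlt
  rw [not_le] at hlt
  have hk0 : k - 1 < k := by have := i.2; omega
  -- The last position can serve as `l` for every other one. At the threshold `C'(K) + 1` no entry
  -- rises, while a position `i` with `C'(i) < C(i)` falls: for `i ≠ K` the circular condition
  -- forces `C'(i) ≤ C'(K) < C(i)`. The count would drop, against `h.le`.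
  set K : Fin k := ⟨k - 1, hk0⟩ with hK
  have hKle : ∀ p : Fin k, p ≠ K → p < K := fun p hp => by
    have h1 : p.1 ≠ k - 1 := fun e => hp (Fin.ext e)
    have := p.2
    simp only [hK, Fin.lt_def]
    omega
  have h1 := h.le ((C' K).1 + 1)
  rw [← cnt_eq_countGE hk hu, ← cnt_eq_countGE hk hc] at h1
  refine absurd h1 (not_le.2 (cnt_lt (fun p hp hpc => ?_) (q := Fin.castLE hk i) i.2 ?_ ?_))
  · rw [extendColumn_of_lt hp] at hpc
    have h2 : val u p = (window hk u ⟨p.1, hp⟩).1 := rfl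
    rw [h2] at hpc
    by_cases hpK : (⟨p.1, hp⟩ : Fin k) = K
    · rw [hpK] at hpc
      omega
    · have h3 := hcond _ _ (hKle _ hpK)
      rw [Fin.sbtw_iff] at h3
      have h4 : (window hk u ⟨p.1, hp⟩).1 ≠ (C' K).1 := fun e => h3.1 (Fin.ext e)
      refine h3.2 (Or.inl ⟨Fin.lt_def.2 ?_, Fin.lt_def.2 ?_⟩) <;> omega
  all_goals
    have hlt' := Fin.lt_def.1 hlt
    rw [window_val] at hlt'
    by_cases hiK : i = K
    · subst hiK
      first
      | rw [hc]; omega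
      | omega
    · have h3 := hcond _ _ (hKle _ hiK)
      rw [Fin.sbtw_iff] at h3
      have h4 : val u (Fin.castLE hk i) ≠ (C' K).1 := fun e => h3.1 (Fin.ext e)
      have h5 := h3.2
      simp only [Fin.lt_def, window_val] at h5
      first
      | rw [hc]; omega
      | omega

/-- When all entries rise weakly, equality of the counts at a threshold means that no entry crosses
it. -/
theorem Compatible.ascent (h : Compatible (window hk u) C')
    (hmono : ∀ i, window hk u i ≤ C' i) : Ascent k (val u) (extendColumn C' u) := by
  have hu : ∀ i, val u (Fin.castLE hk i) = (window hk u i).1 := fun _ => rfl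
  have hc : ∀ i, extendColumn C' u (Fin.castLE hk i) = (C' i).1 := extendColumn_castLE hk
  have hm : ∀ p, val u p ≤ extendColumn C' u p := by
    intro p
    by_cases hp : p.1 < k
    · rw [extendColumn_of_lt hp]
      exact hmono ⟨p.1, hp⟩
    · rw [extendColumn_of_le (not_lt.1 hp)]
  have hcross : ∀ y, countGE (window hk u) y = countGE C' y →
      ∀ p, ¬ (val u p < y ∧ y ≤ extendColumn C' u p) := by
    intro y hy p hpy
    rw [← cnt_eq_countGE hk hu, ← cnt_eq_countGE hk hc] at hy
    by_cases hp : p.1 < k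
    · refine hy.not_lt (cnt_lt (fun q _ => ?_) hp hpy.1 hpy.2)
      have := hm q
      omega
    · rw [extendColumn_of_le (not_lt.1 hp)] at hpy
      omega
  refine ⟨fun p hp => extendColumn_of_le hp, hm, fun p => ?_, fun y => ?_, fun y hy hn p => ?_⟩
  · have h1 := hcross n h.mid p
    have h2 := hm p
    omega
  · by_cases hy : y < 2 * n
    · have h1 := inAbs_iff_memAbs hk hu ⟨y, hy⟩
      have h2 := inAbs_iff_memAbs hk hc ⟨y, hy⟩
      exact h1.trans ((h.abs _).trans h2.symm)
    · have hlt : ∀ p, extendColumn C' u p < 2 * n := fun p => by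
        unfold extendColumn
        split_ifs
        · exact (C' _).2
        · exact val_lt u p
      exact iff_of_false (not_inAbs_of_ge (val_lt u) (not_lt.1 hy))
        (not_inAbs_of_ge hlt (not_lt.1 hy))
  · exact hcross y (h.eq ⟨y, hy⟩ fun h' => hn ((inAbs_iff_memAbs hk hu ⟨y, hy⟩).2 h')) p

end Glue

end TypeC

theorem mainTheorem9 {n k : ℕ} (hk : k ≤ n) (u : TypeC.SignedPerm n)
    (C' : Fin k → TypeC.Letter n) (hC' : TypeC.IsColumn C') :
    ((TypeC.ConditionOne C' (TypeC.window hk u) ∧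
        ∃ D : TypeC.KNColumn n k,
          TypeC.ord C' = D.right ∧ TypeC.ord (TypeC.window hk u) = D.left) ↔
      ∃ P, TypeC.IsRightPath hk u C' P) ∧
    (∀ P Q, TypeC.IsRightPath hk u C' P → TypeC.IsRightPath hk u C' Q → P = Q) ∧
    (∀ P, TypeC.IsRightPath hk u C' P → ∀ i : Fin k,
      ((TypeC.vertices u P).map fun w => TypeC.window hk w i).Pairwise (· ≤ ·) ∧
      ((∀ w ∈ TypeC.vertices u P, TypeC.IsUnbarred (TypeC.window hk w i)) ∨
        (∀ w ∈ TypeC.vertices u P, ¬ TypeC.IsUnbarred (TypeC.window hk w i)))) := by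
  open TypeC in
  refine ⟨⟨?_, ?_⟩, ?_, ?_⟩
  · rintro ⟨hcond, D, hR, hL⟩
    have h := compatible_of_ord_eq D hR hL
    have hmono := window_le_of_conditionOne hk hcond h
    obtain ⟨v, hv, hvc⟩ := exists_reach hk (isCol_extendColumn hC') (h.ascent hk hmono) (by
      intro i l hil hl hb
      have hi : i.1 < k := lt_trans hil hl
      rw [extendColumn_of_lt hi, extendColumn_of_lt hl] at hb
      have h3 := hcond ⟨i.1, hi⟩ ⟨l.1, hl⟩ hil
      rw [Fin.sbtw_iff] at h3
      have h4 : val u i ≠ (C' ⟨l.1, hl⟩).1 := fun e => h3.1 (Fin.ext e)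
      exact h3.2 (Or.inl ⟨Fin.lt_def.2 (lt_of_le_of_ne hb.1 h4), hb.2⟩))
    obtain ⟨P, h1, h2, h3⟩ := hv.exists_path
    refine ⟨P, h1, ?_, by rwa [reverse_GammaR]⟩
    rw [h2]
    funext i
    apply Fin.ext
    rw [window_val, hvc, extendColumn_castLE]
  · rintro ⟨P, h1, h2, h3⟩
    rw [reverse_GammaR] at h3
    have hr := reach_of_path h1 h3
    have hA := hr.ascent fun α => isPlusBelow_of_mem_revGamma
    have hc : ∀ i, val (endpoint u P) (Fin.castLE hk i) = (C' i).1 := fun i => by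
      rw [← h2, window_val]
    refine ⟨conditionOne_of_not_between hk (fun i => ?_) hC' (fun i l hil hb => ?_),
      (hA.compatible hk hc).exists_knColumn (isColumn_window hk) hC'⟩
    · rw [Fin.le_def, ← hc]
      exact hA.mono _
    · have := hr.not_between hk (i := Fin.castLE hk i) (l := Fin.castLE hk l) hil l.2
      rw [hc, hc] at this
      exact this hb
  · rintro P Q ⟨h1, h2, h3⟩ ⟨h4, h5, h6⟩
    rw [reverse_GammaR] at h3 h6
    refine path_unique (hi := hk) h1 h4 h3 h6 fun p hp => ?_
    exact congrArg Fin.val (congrFun (h2.trans h5.symm) ⟨p.1, hp⟩)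
  · rintro P ⟨h1, -, h3⟩ i
    rw [reverse_GammaR] at h3
    obtain ⟨h4, h5⟩ := path_monotone (m := k) h1
      (fun α hα => isPlusBelow_of_mem_revGamma (h3.subset hα)) (Fin.castLE hk i)
    refine ⟨List.pairwise_map.2 h4, ?_⟩
    by_cases hu : val u (Fin.castLE hk i) < n
    · exact Or.inl fun w hw => (h5 w hw).2.1 hu
    · exact Or.inr fun w hw hw' => hu ((h5 w hw).2.2 hw')
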